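/- All graphs are finite and simple. A graph is hamiltonian (traceable) if it contains a spanning cycle (spanning path). A platypus is a non-hamiltonian graph on at least three vertices such that for every vertex $v$ the graph $G-v$ is traceable. Let $\Delta(G)$ denote the maximum degree of $G$. Then the following hold. 1. If $G$ is a platypus of order $n$, then $\Delta(G)\le n-4$. 2. Up to isomorphism there are exactly four platypuses of order at most $9$; each of them has order $9$, one has maximum degree $3$ and the other three have maximum degree $4$. Hence the bound in (1) is not sharp for $n=9$: every platypus $G$ of order $9$ satisfies $\Delta(G)<9-4$. 3. For every integer $n\ge 10$ there exists a platypus $G$ of order $n$ with $\Delta(G)=n-4$. -/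

import Mathlib

/-- A graph is traceable if it contains a spanning (hamiltonian) path. -/
def SimpleGraph.IsTraceable {V : Type*} [DecidableEq V] (G : SimpleGraph V) : Prop :=
  ∃ (a b : V) (p : G.Walk a b), p.IsHamiltonian

/-- A platypus graph: a non-hamiltonian finite simple graph on at least three vertices all of whose
vertex-deleted subgraphs are traceable. -/
structure SimpleGraph.IsPlatypus {V : Type*} [Fintype V] [DecidableEq V]
    (G : SimpleGraph V) : Prop where
  three_le_card : 3 ≤ Fintype.card V
  not_isHamiltonian : ¬ G.IsHamiltonian
  isTraceable_delete : ∀ v : V, (G.induce ({v}ᶜ : Set V)).IsTraceable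

/-! The upper bound rests on Pósa rotations. Suppose that `x` has at most two non-neighbours besides
itself, and take a hamiltonian path of `G - x`. If both its ends are adjacent to `x`, then `x`
closes it to a hamiltonian cycle. If just one end `p` is not adjacent to `x`, then `p` has a second
neighbour `b` on the path, since all degrees are at least two. Rotating along `p b` yields a new end
`a` that must again be a non-neighbour of `x`. A further neighbour of `p` or of `a` would produce a
third non-neighbour in the same way, so both have degree two, with common neighbour `b`
(`false_of_getLast_adj`). If neither end is adjacent to `x`, rotations at both ends again force the
two ends to have degree two and a common neighbour (`false_of_not_adj_ends`). This is impossible: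
two vertices of degree two with common neighbour `y` are the two ends of every hamiltonian path of
`G - y`, and `y` closes that path (`false_of_common_neighbor`).

The bound and minimum degree two leave the orders six to nine for the classification, which is a
certified exhaustive search. The vertices are labelled along a cycle missing one vertex, along a
hamiltonian path, or, in a nontraceable graph, along a hamiltonian path of some `G - v`. A
precomputed decision tree then fixes further pairs as edges or non-edges until every branch is
contradictory or isomorphic to one of four graphs. Soundness is `SearchTree.exists_iso_of_check`;
the kernel only evaluates the checker.

For sharpness, an explicit platypus of order ten has a vertex of degree six. Adding a twin of a
simplicial vertex adjacent to it preserves the platypus property (`IsPlatypus.addTwin`) and raises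
order and degree by one. -/

namespace SimpleGraph

/-! ### Paths and cycles as lists of vertices. -/

variable {V : Type*} (G : SimpleGraph V)

/-- A list of vertices is a path list if it is the support of a path. -/
def IsPathList (l : List V) : Prop := l.Nodup ∧ l.IsChain G.Adj

/-- A list of vertices is a cycle list if it lists the vertices of a cycle in cyclic order. -/
def IsCycleList (l : List V) : Prop :=
  3 ≤ l.length ∧ l.Nodup ∧ l.IsChain G.Adj ∧ ∀ a ∈ l.getLast?, ∀ b ∈ l.head?, G.Adj a b

variable {G}

lemma IsPathList.reverse {l : List V} (h : G.IsPathList l) : G.IsPathList l.reverse :=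
  ⟨List.nodup_reverse.2 h.1, List.isChain_reverse.2 (h.2.imp fun _ _ hab => hab.symm)⟩

lemma IsCycleList.rotate {l₁ l₂ : List V} (h : G.IsCycleList (l₁ ++ l₂)) :
    G.IsCycleList (l₂ ++ l₁) := by
  obtain ⟨h1, h2, h3, h4⟩ := h
  refine ⟨by simpa [add_comm] using h1, List.nodup_append_comm.1 h2, ?_, ?_⟩
  · rw [List.isChain_append] at h3 ⊢
    refine ⟨h3.2.1, h3.1, fun a ha b hb => h4 a ?_ b ?_⟩
    · simp only [Option.mem_def] at ha
      simp [List.getLast?_append, ha]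
    · simp only [Option.mem_def] at hb
      simp [List.head?_append, hb]
  · rcases l₁ with _ | ⟨x, l₁⟩
    · simpa using h4
    rcases l₂.eq_nil_or_concat with rfl | ⟨l₂, y, rfl⟩
    · simpa using h4
    rw [List.isChain_append] at h3
    intro a ha b hb
    refine h3.2.2 a ?_ b ?_
    · simpa [List.getLast?_append] using ha
    · rcases l₂ with _ | ⟨z, l₂⟩ <;> simpa using hb

lemma isTraceable_iff [DecidableEq V] [Nonempty V] :
    G.IsTraceable ↔ ∃ l, G.IsPathList l ∧ ∀ v, v ∈ l := by
  constructor
  · rintro ⟨a, b, p, hp⟩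
    exact ⟨p.support, ⟨hp.isPath.support_nodup, p.isChain_adj_support⟩, hp.mem_support⟩
  · rintro ⟨l, ⟨h1, h2⟩, h3⟩
    have hne : l ≠ [] := List.ne_nil_of_mem (h3 (Classical.arbitrary V))
    refine ⟨_, _, Walk.ofSupport l hne h2, ?_⟩
    refine Walk.IsPath.isHamiltonian_of_mem ?_ ?_
    · rw [Walk.isPath_def, Walk.support_ofSupport]; exact h1
    · rw [Walk.support_ofSupport]; exact h3

lemma isTraceable_induce_compl_singleton_iff [DecidableEq V] [Nontrivial V] (v : V) :
    (G.induce ({v}ᶜ : Set V)).IsTraceable ↔ ∃ l, G.IsPathList l ∧ ∀ u, u ∈ l ↔ u ≠ v := by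
  obtain ⟨w, hw⟩ := exists_ne v
  have : Nonempty ({v}ᶜ : Set V) := ⟨⟨w, hw⟩⟩
  rw [isTraceable_iff]
  constructor
  · rintro ⟨l, ⟨h1, h2⟩, h3⟩
    refine ⟨l.map Subtype.val, ⟨h1.map Subtype.val_injective, ?_⟩, fun u => ⟨?_, fun hu => ?_⟩⟩
    · rw [List.isChain_map]; exact h2
    · intro hu
      obtain ⟨a, -, rfl⟩ := List.mem_map.1 hu
      exact a.2
    · exact List.mem_map.2 ⟨⟨u, hu⟩, h3 _, rfl⟩
  · rintro ⟨l, ⟨h1, h2⟩, h3⟩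
    lift l to List ({v}ᶜ : Set V) using fun u hu => (h3 u).1 hu
    refine ⟨l, ⟨h1.of_map, ?_⟩, fun u => ?_⟩
    · rw [List.isChain_map] at h2; exact h2
    · obtain ⟨a, ha, hau⟩ := List.mem_map.1 ((h3 u).2 u.2)
      rwa [← Subtype.ext hau]

lemma isHamiltonian_iff [Fintype V] [DecidableEq V] (hV : 3 ≤ Fintype.card V) :
    G.IsHamiltonian ↔ ∃ l, G.IsCycleList l ∧ ∀ v, v ∈ l := by
  constructor
  · intro h
    obtain ⟨a, p, hp⟩ := h (by omega)
    have hcyc := hp.isCycle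
    have hlen : p.tail.support.length = Fintype.card V := hp.isHamiltonian_tail.length_support
    refine ⟨p.tail.support, ⟨by omega, ?_, p.tail.isChain_adj_support, ?_⟩,
      hp.isHamiltonian_tail.mem_support⟩
    · exact hp.isHamiltonian_tail.isPath.support_nodup
    · intro x hx y hy
      have hx' : x = a := by
        have : p.tail.support.getLast? = some a := by
          rw [List.getLast?_eq_some_getLast (Walk.support_ne_nil _), Walk.getLast_support]
        rw [this] at hx; simpa using hx.symm
      have hy' : y = p.snd := by
        have : p.tail.support.head? = some p.snd := by
          rw [List.head?_eq_some_head (Walk.support_ne_nil _), Walk.head_support]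
        rw [this] at hy; simpa using hy.symm
      subst hx' hy'
      exact p.adj_snd hcyc.not_nil
  · rintro ⟨l, ⟨h1, h2, h3, h4⟩, h5⟩ -
    have hne : l ≠ [] := by rintro rfl; simp at h1
    have hadj : G.Adj (l.getLast hne) (l.head hne) :=
      h4 _ (List.getLast?_eq_some_getLast hne) _ (List.head?_eq_some_head hne)
    refine ⟨_, Walk.cons hadj (Walk.ofSupport l hne h3), ?_⟩
    have hpath : (Walk.ofSupport l hne h3).IsPath := by
      rw [Walk.isPath_def, Walk.support_ofSupport]; exact h2
    rw [Walk.isHamiltonianCycle_iff_isCycle_and_support_count_tail_eq_one]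
    refine ⟨?_, fun v => ?_⟩
    · rw [Walk.isCycle_iff_isPath_tail_and_le_length]
      refine ⟨by simpa using hpath, ?_⟩
      rw [Walk.length_cons, Walk.length_ofSupport]; omega
    · rw [Walk.support_cons, List.tail_cons, Walk.support_ofSupport]
      exact List.count_eq_one_of_mem h2 (h5 v)

/-- Replaces walks and induced subgraphs by vertex lists in `V`, on which rotations are plain list
operations. -/
lemma isPlatypus_iff [Fintype V] [DecidableEq V] :
    G.IsPlatypus ↔ 3 ≤ Fintype.card V ∧ (∀ l, G.IsCycleList l → ∃ v, v ∉ l) ∧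
      ∀ v, ∃ l, G.IsPathList l ∧ ∀ u, u ∈ l ↔ u ≠ v := by
  constructor
  · rintro ⟨h1, h2, h3⟩
    have : Nontrivial V := Fintype.one_lt_card_iff_nontrivial.1 (by omega)
    refine ⟨h1, fun l hl => ?_, fun v => (isTraceable_induce_compl_singleton_iff v).1 (h3 v)⟩
    rw [isHamiltonian_iff h1] at h2
    by_contra! h
    exact h2 ⟨l, hl, h⟩
  · rintro ⟨h1, h2, h3⟩
    have : Nontrivial V := Fintype.one_lt_card_iff_nontrivial.1 (by omega)
    refine ⟨h1, fun h => ?_, fun v => (isTraceable_induce_compl_singleton_iff v).2 (h3 v)⟩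
    obtain ⟨l, hl, h⟩ := (isHamiltonian_iff h1).1 h
    obtain ⟨v, hv⟩ := h2 l hl
    exact hv (h v)

end SimpleGraph

/-! ### Minimum degree two, and vertices of degree two. -/

namespace SimpleGraph

variable {V : Type*} {G : SimpleGraph V}

lemma IsCycleList.cons {x : V} {l : List V} (hl : G.IsPathList l) (hx : x ∉ l)
    (h2 : 2 ≤ l.length) (hxa : ∀ a ∈ l.head?, G.Adj x a) (hxb : ∀ b ∈ l.getLast?, G.Adj b x) :
    G.IsCycleList (x :: l) := by
  refine ⟨by simp; omega, List.nodup_cons.2 ⟨hx, hl.1⟩, ?_, ?_⟩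
  · rw [List.isChain_cons]; exact ⟨hxa, hl.2⟩
  · rcases l with _ | ⟨y, l⟩
    · simp at h2
    · intro a ha b hb
      simp only [List.head?_cons, Option.mem_def, Option.some.injEq] at hb
      subst hb
      refine hxb a ?_
      simpa using ha

/-- A vertex of a path list with at most one neighbour is one of the two ends. -/
lemma IsPathList.head_or_getLast {l : List V} (hl : G.IsPathList l) {a : V} (ha : a ∈ l)
    (h : ∀ b ∈ l, ∀ c ∈ l, G.Adj a b → G.Adj a c → b = c) :
    l.head? = some a ∨ l.getLast? = some a := by
  obtain ⟨A, B, rfl⟩ := List.append_of_mem ha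
  rcases A.eq_nil_or_concat with rfl | ⟨A, x, rfl⟩
  · simp
  rcases B with _ | ⟨y, B⟩
  · simp
  obtain ⟨h1, h2⟩ := hl
  have hxa : G.Adj x a ∧ G.Adj a y := by
    rw [List.isChain_append] at h2
    have := h2.2.1
    simp only [List.isChain_cons_cons] at this
    refine ⟨h2.2.2 x (by simp) a (by simp), this.1⟩
  have hxy := h x (by simp) y (by simp) hxa.1.symm hxa.2
  subst hxy
  simp [List.nodup_append] at h1

namespace IsPlatypus

variable [Fintype V] [DecidableEq V] (hG : G.IsPlatypus)
include hG

lemma exists_notMem {l : List V} (hl : G.IsCycleList l) : ∃ v, v ∉ l :=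
  (isPlatypus_iff.1 hG).2.1 l hl

lemma exists_isPathList (v : V) : ∃ l, G.IsPathList l ∧ ∀ u, u ∈ l ↔ u ≠ v :=
  (isPlatypus_iff.1 hG).2.2 v

/-- Minimum degree two: for `u ≠ v`, a hamiltonian path of `G - u` has at least two vertices and
passes through `v`, so `v` keeps a neighbour after the deletion of `u`. -/
lemma exists_adj_ne (v u : V) : ∃ w, w ≠ u ∧ G.Adj v w := by
  have key : ∀ u, v ≠ u → ∃ w, w ≠ u ∧ G.Adj v w := by
    intro u hu
    obtain ⟨l, ⟨h1, h2⟩, h3⟩ := hG.exists_isPathList u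
    obtain ⟨w, hw⟩ := Finset.exists_mem_notMem_of_card_lt_card (s := {u, v}) (t := Finset.univ)
      (lt_of_le_of_lt Finset.card_le_two hG.three_le_card)
    simp only [Finset.mem_univ, Finset.mem_insert, Finset.mem_singleton, not_or, true_and] at hw
    have hwl := (h3 w).2 hw.1
    obtain ⟨A, B, rfl⟩ := List.append_of_mem ((h3 v).2 hu)
    rw [List.isChain_append] at h2
    rcases B with _ | ⟨b, B⟩
    · rcases A.eq_nil_or_concat with rfl | ⟨A, a, rfl⟩
      · simp [hw.2] at hwl
      · exact ⟨a, (h3 a).1 (by simp), (h2.2.2 a (by simp) v (by simp)).symm⟩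
    · exact ⟨b, (h3 b).1 (by simp), (List.isChain_cons_cons.1 h2.2.1).1⟩
  by_cases hu : v = u
  · subst hu
    obtain ⟨w, hw⟩ := Fintype.exists_ne_of_one_lt_card (by have := hG.three_le_card; omega) v
    obtain ⟨z, -, hz⟩ := key w hw.symm
    exact ⟨z, hz.ne', hz⟩
  · exact key u hu

/-- In a platypus, no vertex is adjacent to two vertices of degree two. -/
lemma false_of_common_neighbor {y a a' b b' : V} (hab : a ≠ b) (hya : G.Adj y a)
    (hyb : G.Adj y b) (ha : ∀ w, G.Adj a w → w = y ∨ w = a')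
    (hb : ∀ w, G.Adj b w → w = y ∨ w = b') : False := by
  obtain ⟨l, hl, hm⟩ := hG.exists_isPathList y
  have hal := (hm a).2 hya.ne'
  have hbl := (hm b).2 hyb.ne'
  have hy : y ∉ l := fun h => (hm y).1 h rfl
  have h2 : 2 ≤ l.length := by
    rcases l with _ | ⟨c, _ | ⟨d, l⟩⟩
    · simp at hal
    · simp only [List.mem_singleton] at hal hbl; exact absurd (hal.trans hbl.symm) hab
    · simp
  -- Outside `y`, each of `a` and `b` has at most one neighbour, so each is an end of the
  -- hamiltonian path `l` of `G - y`.
  have ha' := hl.head_or_getLast hal (fun u hu w hw hau haw => by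
    rw [(ha u hau).resolve_left ((hm u).1 hu), (ha w haw).resolve_left ((hm w).1 hw)])
  have hb' := hl.head_or_getLast hbl (fun u hu w hw hau haw => by
    rw [(hb u hau).resolve_left ((hm u).1 hu), (hb w haw).resolve_left ((hm w).1 hw)])
  -- As `a ≠ b`, they are opposite ends, and `y` is adjacent to both.
  have hends : (∀ c ∈ l.head?, G.Adj y c) ∧ ∀ c ∈ l.getLast?, G.Adj c y := by
    rcases ha' with h | h <;> rcases hb' with h' | h'
    · rw [h] at h'; simp [hab] at h'
    · simp [h, h', hya, hyb.symm]
    · simp [h, h', hyb, hya.symm]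
    · rw [h] at h'; simp [hab] at h'
  obtain ⟨v, hv⟩ := hG.exists_notMem (IsCycleList.cons hl hy h2 hends.1 hends.2)
  rw [List.mem_cons, not_or] at hv
  exact hv.2 ((hm v).2 hv.1)

end IsPlatypus
end SimpleGraph

/-! ### Rotations, and the case of exactly one end adjacent to `x`. -/

namespace SimpleGraph

variable {V : Type*} {G : SimpleGraph V}

/-- Pósa rotation: the edge from the first vertex `p` to `b` replaces the path edge entering `b`,
which reverses the initial segment. -/
lemma IsPathList.rotate {p b : V} {A B : List V} (h : G.IsPathList (p :: A ++ b :: B))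
    (hpb : G.Adj p b) : G.IsPathList ((p :: A).reverse ++ b :: B) := by
  obtain ⟨h1, h2⟩ := h
  rw [List.isChain_append] at h2
  refine ⟨?_, List.isChain_append.2 ⟨?_, h2.2.1, ?_⟩⟩
  · have : ((p :: A).reverse ++ b :: B).Perm (p :: A ++ b :: B) :=
      (List.reverse_perm _).append_right _
    exact this.nodup_iff.2 h1
  · exact List.isChain_reverse.2 (h2.1.imp fun _ _ hab => hab.symm)
  · simpa using hpb

namespace IsPlatypus

variable [Fintype V] [DecidableEq V] (hG : G.IsPlatypus)
include hG

/-- Otherwise `x` would close the path to a hamiltonian cycle; order at least three makes that cycle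
long enough. -/
lemma not_isPathList_of_adj_ends {x : V} {l : List V} (hl : G.IsPathList l)
    (hm : ∀ u, u ∈ l ↔ u ≠ x) (h1 : ∀ a ∈ l.head?, G.Adj x a)
    (h2 : ∀ b ∈ l.getLast?, G.Adj b x) : False := by
  have hx : x ∉ l := fun h => (hm x).1 h rfl
  have hlen : 2 ≤ l.length := by
    have : Finset.univ ⊆ insert x l.toFinset := fun v _ => by
      by_cases hv : v = x <;> simp [hv, hm]
    have h := Finset.card_le_card this
    have h' := Finset.card_insert_le x l.toFinset
    have h'' := l.toFinset_card_le
    have := hG.three_le_card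
    rw [Finset.card_univ] at h
    omega
  obtain ⟨v, hv⟩ := hG.exists_notMem (IsCycleList.cons hl hx hlen h1 h2)
  rw [List.mem_cons, not_or] at hv
  exact hv.2 ((hm v).2 hv.1)

/-- Rotation along `p b` makes the predecessor `a` of `b` the new first vertex and keeps the last
one, a neighbour of `x`. Adjacency of `x` and `a` would close the rotated path. -/
lemma not_adj_of_rotate {x p a b : V} {A B : List V} (hl : G.IsPathList (p :: A ++ b :: B))
    (hm : ∀ u, u ∈ p :: A ++ b :: B ↔ u ≠ x) (hlast : ∀ c ∈ (b :: B).getLast?, G.Adj c x)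
    (hpb : G.Adj p b) (ha : A.getLast? = some a) : ¬ G.Adj x a := by
  intro hxa
  refine hG.not_isPathList_of_adj_ends (x := x) (hl.rotate hpb) (fun u => ?_) ?_ ?_
  · rw [← hm]; simp; tauto
  · intro c hc
    obtain ⟨A, rfl⟩ : ∃ A', A = A' ++ [a] := by
      rcases A.eq_nil_or_concat with rfl | ⟨A, y, rfl⟩
      · simp at ha
      · exact ⟨A, by simpa using ha⟩
    simp at hc
    rwa [← hc]
  · intro c hc
    refine hlast c ?_
    simpa [List.getLast?_append] using hc

/-- Both `p` and `a` are non-neighbours of `x`, and `hnon` allows no third one. Rotating along an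
edge from `p` to another vertex `w` would make the predecessor of `w` the third. -/
lemma neighbors_of_rotate {x p s a b : V} {A B : List V}
    (hnon : ∀ p q r, p ≠ q → p ≠ r → q ≠ r → p ≠ x → q ≠ x → r ≠ x →
      G.Adj x p ∨ G.Adj x q ∨ G.Adj x r)
    (hl : G.IsPathList (p :: A ++ b :: B))
    (hm : ∀ u, u ∈ p :: A ++ b :: B ↔ u ≠ x) (hlast : ∀ c ∈ (b :: B).getLast?, G.Adj c x)
    (hxp : ¬ G.Adj x p) (hpb : G.Adj p b) (hs : A.head? = some s) (ha : A.getLast? = some a) :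
    ∀ w, G.Adj p w → w = b ∨ w = s := by
  have hxa := hG.not_adj_of_rotate hl hm hlast hpb ha
  have haA : a ∈ A := List.mem_of_mem_getLast? ha
  intro w hw
  have hwx : w ≠ x := by rintro rfl; exact hxp hw.symm
  have hwl := (hm w).2 hwx
  have hnd := hl.1
  by_contra! hne
  -- The vertex `c` is the predecessor of `w` on the path: it differs from `p` because `w ≠ s`, and
  -- from `a` because `w ≠ b`.
  obtain ⟨c, hc, hcx⟩ : ∃ c, c ∈ A ++ b :: B ∧ c ≠ a ∧ ¬ G.Adj x c := by
    rw [List.cons_append, List.mem_cons, List.mem_append, List.mem_cons] at hwl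
    rcases hwl with rfl | hwl | rfl | hwl
    · exact absurd rfl hw.ne
    · obtain ⟨C, D, rfl⟩ := List.append_of_mem hwl
      rcases C.eq_nil_or_concat with rfl | ⟨C, c, rfl⟩
      · simp at hs; exact absurd hs hne.2
      refine ⟨c, by simp, ?_, ?_⟩
      · rintro rfl
        have : c ∈ w :: D := by
          refine List.mem_of_mem_getLast? (l := w :: D) ?_
          simpa [List.getLast?_append] using ha
        simp only [List.append_assoc, List.cons_append, List.nodup_cons, List.nodup_append] at hnd
        grind
      · refine hG.not_adj_of_rotate (p := p) (b := w) (A := C ++ [c]) (B := D ++ b :: B)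
          (by simpa using hl) (by simpa using hm) ?_ hw (by simp)
        intro d hd
        exact hlast d (by simpa [List.getLast?_append, List.getLast?_cons] using hd)
    · exact absurd rfl hne.1
    · obtain ⟨C, D, rfl⟩ := List.append_of_mem hwl
      have hc : ∃ c, (A ++ b :: C).getLast? = some c ∧ c ∈ b :: C := by
        obtain ⟨c, hc⟩ := Option.isSome_iff_exists.1 (show ((b :: C).getLast?).isSome by simp)
        exact ⟨c, by rw [List.getLast?_append, hc]; rfl, List.mem_of_mem_getLast? hc⟩
      obtain ⟨c, hc, hcm⟩ := hc
      refine ⟨c, by simp at hcm ⊢; tauto, ?_, ?_⟩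
      · rintro rfl
        simp only [List.cons_append, List.nodup_cons, List.nodup_append] at hnd
        grind
      · refine hG.not_adj_of_rotate (p := p) (b := w) (A := A ++ b :: C) (B := D)
          (by simpa using hl) (by simpa using hm) ?_ hw hc
        intro d hd
        exact hlast d (by simpa [List.getLast?_append, List.getLast?_cons] using hd)
  have hp : p ∉ A ++ b :: B := (List.nodup_cons.1 hnd).1
  have hx : ∀ u ∈ p :: A ++ b :: B, u ≠ x := fun u => (hm u).1
  rcases hnon p a c (by grind) (by grind) (Ne.symm hcx.1) (hx _ (by simp)) (hx _ (by simp [haA]))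
    (hx _ (by rw [List.cons_append]; exact List.mem_cons_of_mem _ hc)) with h | h | h
  · exact hxp h
  · exact hxa h
  · exact hcx.2 h

lemma false_of_getLast_adj {x p : V} {l : List V}
    (hnon : ∀ p q r, p ≠ q → p ≠ r → q ≠ r → p ≠ x → q ≠ x → r ≠ x →
      G.Adj x p ∨ G.Adj x q ∨ G.Adj x r)
    (hl : G.IsPathList (p :: l)) (hm : ∀ u, u ∈ p :: l ↔ u ≠ x)
    (hlast : ∀ c ∈ (p :: l).getLast?, G.Adj c x) (hxp : ¬ G.Adj x p) : False := by
  have hx : ∀ w, G.Adj p w → w ≠ x := by rintro w hw rfl; exact hxp hw.symm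
  rcases l with _ | ⟨s, l⟩
  · exact hxp (hlast p (by simp)).symm
  obtain ⟨b, hbs, hpb⟩ := hG.exists_adj_ne p s
  have hb : b ∈ l := by
    have := (hm b).2 (hx b hpb)
    have := hpb.ne'
    simp_all
  obtain ⟨C, B, rfl⟩ := List.append_of_mem hb
  have hlast' : ∀ c ∈ (b :: B).getLast?, G.Adj c x := by
    intro c hc
    exact hlast c (by simpa [List.getLast?_append, List.getLast?_cons] using hc)
  obtain ⟨a, ha⟩ := Option.isSome_iff_exists.1 (show ((s :: C).getLast?).isSome by simp)
  obtain ⟨A', hA'⟩ : ∃ A', s :: C = A' ++ [a] := by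
    rcases (s :: C).eq_nil_or_concat with h | ⟨A, y, h⟩
    · simp at h
    · rw [h] at ha
      simp at ha
      exact ⟨A, by rw [h, ha]; simp⟩
  have hl' : G.IsPathList (p :: (s :: C) ++ b :: B) := by simpa using hl
  have hm' : ∀ u, u ∈ p :: (s :: C) ++ b :: B ↔ u ≠ x := by simpa using hm
  have hN := hG.neighbors_of_rotate hnon hl' hm' hlast' hxp hpb (s := s) (by simp) ha
  have hxa := hG.not_adj_of_rotate hl' hm' hlast' hpb ha
  have hrot := hl'.rotate hpb
  have hab : G.Adj a b := by
    have := hl'.2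
    rw [List.isChain_append] at this
    exact this.2.2 a (by rw [hA']; simp [List.getLast?_cons]) b (by simp)
  have e : (p :: s :: C).reverse ++ b :: B = a :: (A'.reverse ++ [p]) ++ b :: B := by
    rw [hA']; simp
  rw [e] at hrot
  obtain ⟨t, ht⟩ := Option.isSome_iff_exists.1 (show ((A'.reverse ++ [p]).head?).isSome by simp)
  -- On the rotated path the roles are exchanged: `a` is the first vertex and `p` the predecessor of
  -- `b`.
  have hN' := hG.neighbors_of_rotate hnon hrot (fun u => by rw [← e, ← hm']; simp; tauto) hlast' hxa hab
    ht (a := p) (by simp)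
  refine hG.false_of_common_neighbor (y := b) (a := p) (b := a) ?_ hpb.symm hab.symm hN hN'
  rintro rfl
  have := hl'.1
  rw [hA'] at this
  simp at this

end IsPlatypus
end SimpleGraph

/-! ### The case of no end adjacent to `x`, and the degree bound. -/

namespace SimpleGraph

variable {V : Type*} {G : SimpleGraph V}

namespace IsPlatypus

variable [Fintype V] [DecidableEq V] (hG : G.IsPlatypus)
include hG

/-- Rotation along `p b` gives a path `T ++ [q]` that starts at the predecessor of `b`, a neighbour
of `x`. For a neighbour `i` of `q` with successor `c` in `T`, rotating at the other end along `q i`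
makes `c` the last vertex, so `c` is not adjacent to `x`. This forces `c = p`, and the predecessor
of `p` in `T` is `s`. Otherwise `i` is the last vertex of `T`. -/
lemma neighbors_of_not_adj_ends {x p q s b : V} {A B : List V}
    (hxp : ¬ G.Adj x p) (hxq : ¬ G.Adj x q) (hx : ∀ w, w ≠ x → w ≠ p → w ≠ q → G.Adj x w)
    (hl : G.IsPathList (p :: (s :: A) ++ b :: (B ++ [q])))
    (hm : ∀ u, u ∈ p :: (s :: A) ++ b :: (B ++ [q]) ↔ u ≠ x) (hpb : G.Adj p b) :
    ∀ i, G.Adj q i → i = s ∨ (b :: B).getLast? = some i := by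
  intro i hqi
  have hrot := hl.rotate hpb
  obtain ⟨T, hT⟩ : ∃ T, T = (s :: A).reverse ++ p :: b :: B := ⟨_, rfl⟩
  have e : (p :: s :: A).reverse ++ b :: (B ++ [q]) = T ++ [q] := by simp [hT]
  rw [e] at hrot
  have hmT : ∀ u, u ∈ T ++ [q] ↔ u ≠ x := fun u => by
    rw [← e, ← hm]; simp; tauto
  have hi : i ∈ T := by
    have h1 := (hmT i).2 (by rintro rfl; exact hxq hqi.symm)
    have h2 := hqi.ne'
    simp_all
  obtain ⟨H, D, hHD⟩ := List.append_of_mem hi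
  rcases D with _ | ⟨c, D⟩
  · right
    have : T.getLast? = some i := by rw [hHD]; simp
    rw [hT, List.getLast?_append] at this
    simpa [List.getLast?_cons] using this
  left
  have e2 : T ++ [q] = (H ++ [i]) ++ (c :: D ++ [q]) := by rw [hHD]; simp
  have hTn : T.Nodup := (List.nodup_append.1 hrot.1).1
  have hcx : ¬ G.Adj x c := by
    intro hxc
    have hchain := hrot.2
    rw [e2, List.isChain_append] at hchain
    refine hG.not_isPathList_of_adj_ends (x := x) (l := (H ++ [i]) ++ (c :: D ++ [q]).reverse)
      ⟨?_, List.isChain_append.2 ⟨hchain.1, ?_, ?_⟩⟩ (fun u => ?_) ?_ ?_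
    · have h := hrot.1
      rw [e2] at h
      exact ((List.reverse_perm _).append_left _).nodup_iff.2 h
    · exact List.isChain_reverse.2 (hchain.2.1.imp fun _ _ hab => hab.symm)
    · simp only [List.getLast?_append, List.reverse_append]
      simpa using hqi.symm
    · rw [← hmT, e2]; simp; tauto
    · intro a ha
      have ha' : T.head? = some a := by
        rw [hHD]
        rcases H with _ | ⟨h, H⟩ <;> simpa using ha
      have haA : a ∈ s :: A := by
        refine List.mem_of_mem_getLast? (l := s :: A) ?_
        rw [hT, List.head?_append] at ha'
        simpa [List.getLast?_cons] using ha'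
      have hnd := hl.1
      refine hx a ((hm a).1 (by simp at haA ⊢; tauto)) ?_ ?_
      · rintro rfl
        simp only [List.cons_append, List.nodup_cons, List.mem_append, List.mem_cons] at hnd haA
        tauto
      · rintro rfl
        rw [List.cons_append, List.nodup_cons, List.nodup_append] at hnd
        exact hnd.2.2.2 a haA a (by simp) rfl
    · intro a ha
      simp [List.getLast?_cons] at ha
      rw [← ha]; exact hxc.symm
  have hc : c = p := by
    by_contra hcp
    refine hcx (hx c ((hmT c).1 (by rw [e2]; simp)) hcp ?_)
    rintro rfl
    have h := hrot.1
    rw [e2] at h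
    simp [List.nodup_append] at h
  subst hc
  have e3 : (s :: A).reverse ++ c :: (b :: B) = (H ++ [i]) ++ c :: D := by
    rw [← hT, hHD]; simp
  have hnd : (s :: A).reverse = H ++ [i] := by
    refine (List.append_cons_inj_of_notMem ?_ ?_).1 e3 |>.1
    · intro h
      rw [hT] at hTn
      exact (List.nodup_append.1 hTn).2.2 c h c (by simp) rfl
    · rw [hT] at hTn
      exact (List.nodup_cons.1 (List.nodup_append.1 hTn).2.1).1
  have := congrArg List.getLast? hnd
  simpa using this.symm

/-- Let `s` and `t` be the vertices of the path next to `p` and `q`. Rotations confine the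
neighbours of both ends to `s` and `t`, so by minimum degree two the ends share a neighbour. -/
lemma false_of_not_adj_ends {x p q : V} {M : List V} (hxp : ¬ G.Adj x p) (hxq : ¬ G.Adj x q)
    (hx : ∀ w, w ≠ x → w ≠ p → w ≠ q → G.Adj x w) (hl : G.IsPathList (p :: (M ++ [q])))
    (hm : ∀ u, u ∈ p :: (M ++ [q]) ↔ u ≠ x) : False := by
  have hMx : ∀ w ∈ M, G.Adj x w := by
    intro w hw
    have hnd := hl.1
    simp only [List.nodup_cons, List.nodup_append] at hnd
    refine hx w ((hm w).1 (by simp [hw])) ?_ ?_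
    · rintro rfl; exact hnd.1 (by simp [hw])
    · rintro rfl; exact hnd.2.2.2 w hw w (by simp) rfl
  have hxM : ∀ w, G.Adj x w → w ∈ M := by
    intro w hw
    have := (hm w).2 hw.ne'
    simp only [List.mem_cons, List.mem_append, List.not_mem_nil, or_false] at this
    rcases this with rfl | h | rfl
    · exact absurd hw hxp
    · exact h
    · exact absurd hw hxq
  have hpx : ∀ w, G.Adj p w → w ≠ x := by rintro w hw rfl; exact hxp hw.symm
  have hqx : ∀ w, G.Adj q w → w ≠ x := by rintro w hw rfl; exact hxq hw.symm
  obtain ⟨u, -, hu⟩ := hG.exists_adj_ne x x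
  rcases M with _ | ⟨s, M⟩
  · simpa using hxM u hu
  obtain ⟨w, hws, hw⟩ := hG.exists_adj_ne x s
  have hM : M ≠ [] := by rintro rfl; exact hws (by simpa using hxM w hw)
  -- If `p` and `q` were adjacent, the path would close to a cycle through `G - x`, into which `x`
  -- could be inserted between its consecutive neighbours `s` and `m`.
  have hpq : ¬ G.Adj p q := by
    intro hpq
    obtain ⟨m, M, rfl⟩ := List.exists_cons_of_ne_nil hM
    have hchain := hl.2
    simp only [List.cons_append, List.isChain_cons_cons] at hchain
    have e : p :: (s :: m :: M ++ [q]) = [p, s] ++ (m :: M ++ [q]) := by simp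
    rw [e] at hl hm
    refine hG.not_isPathList_of_adj_ends (x := x) (l := (m :: M ++ [q]) ++ [p, s])
      ⟨List.nodup_append_comm.1 hl.1, ?_⟩ (fun v => by rw [← hm]; simp; tauto) ?_ ?_
    · rw [List.isChain_append]
      exact ⟨hchain.2.2, by simpa using hchain.1, by simpa [List.getLast?_cons] using hpq.symm⟩
    · simpa using hMx m (by simp)
    · rw [List.getLast?_append]
      simpa using (hMx s (by simp)).symm
  obtain ⟨M, t, rfl⟩ := (List.eq_nil_or_concat M).resolve_left hM
  simp only [List.concat_eq_append] at *
  have hnd := hl.1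
  obtain ⟨b, hbs, hpb⟩ := hG.exists_adj_ne p s
  obtain ⟨i, hit, hqi⟩ := hG.exists_adj_ne q t
  have hbM : b ∈ M ++ [t] := by
    have h1 := (hm b).2 (hpx b hpb)
    have h2 := hpb.ne'
    have h3 : b ≠ q := by rintro rfl; exact hpq hpb
    simp_all
  have hiM : i ∈ s :: M := by
    have h1 := (hm i).2 (hqx i hqi)
    have h2 := hqi.ne'
    have h3 : i ≠ p := by rintro rfl; exact hpq hqi.symm
    simp_all
  have hNq : ∀ w, G.Adj q w → w = s ∨ w = t := by
    obtain ⟨A, B, hAB⟩ := List.append_of_mem hbM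
    have e : p :: (s :: (M ++ [t]) ++ [q]) = p :: (s :: A) ++ b :: (B ++ [q]) := by
      rw [hAB]; simp
    have hB : (b :: B).getLast? = some t := by
      have := congrArg List.getLast? hAB
      rw [List.getLast?_append] at this
      simpa [List.getLast?_append, List.getLast?_cons] using this.symm
    intro w hw
    have := hG.neighbors_of_not_adj_ends hxp hxq hx (e ▸ hl) (e ▸ hm) hpb w hw
    rw [hB] at this
    exact this.imp_right fun h => (Option.some.inj h).symm
  -- The same argument on the reversed path, where the neighbour `i ≠ t` of `q` serves for the first
  -- rotation.
  have hNp : ∀ w, G.Adj p w → w = s ∨ w = t := by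
    obtain ⟨B, A, hBA⟩ := List.append_of_mem hiM
    have e : (p :: (s :: (M ++ [t]) ++ [q])).reverse =
        q :: (t :: A.reverse) ++ i :: (B.reverse ++ [p]) := by
      have : p :: (s :: (M ++ [t]) ++ [q]) = p :: ((s :: M) ++ [t, q]) := by simp
      rw [this, hBA]; simp
    have hB : (i :: B.reverse).getLast? = some s := by
      have := congrArg List.head? hBA
      rw [List.head?_append] at this
      simp only [List.head?_cons] at this
      rcases B with _ | ⟨c, B⟩ <;> simpa [List.getLast?_cons] using this.symm
    have hl' := hl.reverse
    have hm' : ∀ u, u ∈ (p :: (s :: (M ++ [t]) ++ [q])).reverse ↔ u ≠ x := by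
      intro u; rw [List.mem_reverse, hm]
    intro w hw
    have := hG.neighbors_of_not_adj_ends hxq hxp (fun w h1 h2 h3 => hx w h1 h3 h2) (e ▸ hl')
      (e ▸ hm') hqi w hw
    rw [hB] at this
    exact this.symm.imp (fun h => (Option.some.inj h).symm) id
  have his : i = s := (hNq i hqi).resolve_right hit
  have hps : G.Adj p s := by
    have := hl.2
    simp only [List.cons_append, List.isChain_cons_cons] at this
    exact this.1
  refine hG.false_of_common_neighbor (y := s) (a := p) (b := q) ?_ hps.symm (his ▸ hqi).symm hNp hNq
  rintro rfl
  simp at hnd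

/-- In a platypus every vertex has at least three non-neighbours. -/
lemma exists_three_not_adj (x : V) : ∃ p q r, p ≠ q ∧ p ≠ r ∧ q ≠ r ∧ p ≠ x ∧ q ≠ x ∧ r ≠ x ∧
    ¬ G.Adj x p ∧ ¬ G.Adj x q ∧ ¬ G.Adj x r := by
  by_contra! hnon'
  have hnon : ∀ p q r, p ≠ q → p ≠ r → q ≠ r → p ≠ x → q ≠ x → r ≠ x →
      G.Adj x p ∨ G.Adj x q ∨ G.Adj x r := by
    intro p q r h1 h2 h3 h4 h5 h6
    have := hnon' p q r h1 h2 h3 h4 h5 h6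
    tauto
  obtain ⟨l, hl, hm⟩ := hG.exists_isPathList x
  obtain ⟨u, hu, -⟩ := hG.exists_adj_ne x x
  obtain ⟨p, l, rfl⟩ := List.exists_cons_of_ne_nil (List.ne_nil_of_mem ((hm u).2 hu))
  by_cases hxp : G.Adj x p
  · by_cases hlast : ∀ c ∈ (p :: l).getLast?, G.Adj c x
    · exact hG.not_isPathList_of_adj_ends hl hm (by simpa using hxp) hlast
    · push Not at hlast
      obtain ⟨c, hc, hcx⟩ := hlast
      have hl' := hl.reverse
      have hm' : ∀ u, u ∈ (p :: l).reverse ↔ u ≠ x := by intro u; rw [List.mem_reverse, hm]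
      rcases (p :: l).eq_nil_or_concat with h | ⟨L, y, h⟩
      · simp at h
      · have hyc : y = c := by simpa [h] using hc
        subst hyc
        have hrev : (p :: l).reverse = y :: L.reverse := by rw [h]; simp
        have hlast : ∀ z ∈ (p :: l).reverse.getLast?, G.Adj z x := by
          rw [List.getLast?_reverse]; simpa using hxp.symm
        rw [hrev] at hl' hm' hlast
        exact hG.false_of_getLast_adj hnon hl' hm' hlast fun h => hcx h.symm
  · by_cases hlast : ∀ c ∈ (p :: l).getLast?, G.Adj c x
    · exact hG.false_of_getLast_adj hnon hl hm hlast hxp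
    · push Not at hlast
      obtain ⟨q, hq, hqx⟩ := hlast
      rcases l.eq_nil_or_concat with rfl | ⟨M, y, rfl⟩
      · obtain ⟨w, hw, hxw⟩ := hG.exists_adj_ne x x
        have := (hm w).2 hw
        simp only [List.mem_singleton] at this
        exact hxp (this ▸ hxw)
      · rw [List.concat_eq_append] at *
        have hyq : y = q := by simpa [List.getLast?_cons] using hq
        subst hyq
        have hpy : p ≠ y := by
          rintro rfl
          have := hl.1
          simp at this
        refine hG.false_of_not_adj_ends hxp (fun h => hqx h.symm) ?_ hl hm
        intro w hwx hwp hwy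
        have hpx := (hm p).1 (by simp)
        have hyx := (hm y).1 (by simp)
        rcases hnon p y w hpy hwp.symm hwy.symm hpx hyx hwx with h | h | h
        · exact absurd h hxp
        · exact absurd h.symm hqx
        · exact h

lemma degree_add_four_le [DecidableRel G.Adj] (x : V) : G.degree x + 4 ≤ Fintype.card V := by
  obtain ⟨p, q, r, h1, h2, h3, h4, h5, h6, h7, h8, h9⟩ := hG.exists_three_not_adj x
  have hd : Disjoint (G.neighborFinset x) {x, p, q, r} := by
    rw [Finset.disjoint_left]
    intro w hw
    rw [mem_neighborFinset] at hw
    simp only [Finset.mem_insert, Finset.mem_singleton]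
    rintro (rfl | rfl | rfl | rfl)
    · exact G.loopless.irrefl _ hw
    all_goals contradiction
  have hc : ({x, p, q, r} : Finset V).card = 4 := by
    rw [Finset.card_eq_succ]
    refine ⟨x, {p, q, r}, by simp [h4.symm, h5.symm, h6.symm], rfl, ?_⟩
    exact Finset.card_eq_three.2 ⟨p, q, r, h1, h2, h3, rfl⟩
  have := Finset.card_le_univ (G.neighborFinset x ∪ {x, p, q, r})
  rwa [Finset.card_union_of_disjoint hd, hc, card_neighborFinset_eq_degree] at this

lemma maxDegree_add_four_le [DecidableRel G.Adj] : G.maxDegree + 4 ≤ Fintype.card V := by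
  have : Nonempty V := Fintype.card_pos_iff.1 (by have := hG.three_le_card; omega)
  obtain ⟨x, hx⟩ := G.exists_maximal_degree_vertex
  rw [hx]
  exact hG.degree_add_four_le x

end IsPlatypus
end SimpleGraph

/-! ### Exhaustive search for hamiltonian cycles and paths in labelled graphs. -/

namespace SimpleGraph

/-- The graph on `Fin n` with the given list of edges. -/
def ofEdges (n : ℕ) (es : List (ℕ × ℕ)) : SimpleGraph (Fin n) where
  Adj i j := i ≠ j ∧ ((i.1, j.1) ∈ es ∨ (j.1, i.1) ∈ es)
  symm := ⟨fun _ _ h => ⟨h.1.symm, h.2.symm⟩⟩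
  loopless := ⟨fun _ h => h.1 rfl⟩

instance (n : ℕ) (es : List (ℕ × ℕ)) : DecidableRel (ofEdges n es).Adj :=
  fun i j => inferInstanceAs (Decidable (i ≠ j ∧ ((i.1, j.1) ∈ es ∨ (j.1, i.1) ∈ es)))

/-- Depth-first search for a path with respect to `r` that starts at `c`, runs through `k` vertices
of the list `l` and ends in a vertex satisfying `final`. -/
def canExtend (r : ℕ → ℕ → Bool) (final : ℕ → Bool) : ℕ → ℕ → List ℕ → Bool
  | 0, c, _ => final c
  | k + 1, c, l => l.any fun x => r c x && canExtend r final k x (l.erase x)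

/-- Only this direction is needed: a search returning `false` certifies that there is no path. -/
lemma canExtend_eq_true {r : ℕ → ℕ → Bool} {final : ℕ → Bool} {t : List ℕ} :
    ∀ {c : ℕ} {l : List ℕ}, t.Perm l → (c :: t).IsChain (fun i j => r i j = true) →
      (∀ d ∈ (c :: t).getLast?, final d = true) → canExtend r final t.length c l = true := by
  induction t with
  | nil => intro c l _ _ h; simpa [canExtend] using h
  | cons a t ih =>
    intro c l hp hc hd
    rw [List.isChain_cons_cons] at hc
    simp only [List.length_cons, canExtend, List.any_eq_true, Bool.and_eq_true]
    refine ⟨a, hp.subset (by simp), hc.1, ih ?_ hc.2 ?_⟩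
    · simpa using hp.erase a
    · intro d h
      exact hd d (by simpa [List.getLast?_cons] using h)

variable {V : Type*} {G : SimpleGraph V}

/-- A labelling of the vertices of a finite type by `0, …, n - 1`. -/
structure IsLabelling (g : V → ℕ) (n : ℕ) : Prop where
  injective : Function.Injective g
  range_eq : Set.range g = Set.Iio n

namespace IsLabelling

variable {g : V → ℕ} {n : ℕ} (hg : IsLabelling g n)
include hg

lemma lt (v : V) : g v < n := by
  have : g v ∈ Set.range g := ⟨v, rfl⟩
  rwa [hg.range_eq] at this

lemma exists_eq {i : ℕ} (hi : i < n) : ∃ v, g v = i := by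
  have : i ∈ Set.range g := by rw [hg.range_eq]; exact hi
  exact this

lemma exists_map_eq {l : List ℕ} (hl : ∀ i ∈ l, i < n) : ∃ l' : List V, l'.map g = l := by
  have : l ∈ Set.range (List.map g) := by
    rw [Set.range_list_map]
    intro i hi
    exact hg.exists_eq (hl i hi)
  exact this

lemma map_perm {l : List V} (hl : l.Nodup) (hm : ∀ v, v ∈ l) : (l.map g).Perm (List.range n) := by
  rw [List.perm_ext_iff_of_nodup (hl.map hg.injective) List.nodup_range]
  intro i
  rw [List.mem_map, List.mem_range]
  constructor
  · rintro ⟨v, -, rfl⟩; exact hg.lt v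
  · intro hi
    obtain ⟨v, rfl⟩ := hg.exists_eq hi
    exact ⟨v, hm v, rfl⟩

lemma map_perm_erase {l : List V} (hl : l.Nodup) {w : V} (hm : ∀ v, v ∈ l ↔ v ≠ w) :
    (l.map g).Perm ((List.range n).erase (g w)) := by
  have h1 : (w :: l).Nodup := List.nodup_cons.2 ⟨fun h => (hm w).1 h rfl, hl⟩
  have := hg.map_perm h1 fun v => by rw [List.mem_cons, hm]; exact eq_or_ne v w
  simpa using this.erase (g w)

end IsLabelling

/-- Search for a cycle through all of `0, …, n - 1`. -/
def searchCycle (r : ℕ → ℕ → Bool) (n : ℕ) : Bool :=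
  canExtend r (fun c => r c 0) (n - 1) 0 ((List.range n).erase 0)

/-- Search for a path through all of `0, …, n - 1` except `w`. -/
def searchPath (r : ℕ → ℕ → Bool) (n w : ℕ) : Bool :=
  ((List.range n).erase w).any fun c =>
    canExtend r (fun _ => true) (n - 2) c (((List.range n).erase w).erase c)

lemma searchCycle_eq_true {g : V → ℕ} {n : ℕ} (hg : IsLabelling g n) {r : ℕ → ℕ → Bool}
    (hr : ∀ u v, G.Adj u v → r (g u) (g v) = true) {l : List V} (hl : G.IsCycleList l)
    (hm : ∀ v, v ∈ l) : searchCycle r n = true := by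
  have hn : 0 < n := by
    obtain ⟨v, -⟩ := List.exists_mem_of_length_pos (l := l) (by have := hl.1; omega)
    exact lt_of_le_of_lt (Nat.zero_le _) (hg.lt v)
  obtain ⟨v, hv⟩ := hg.exists_eq hn
  -- The cycle is rotated to begin at the vertex labelled `0`, where the search starts.
  obtain ⟨A, B, rfl⟩ := List.append_of_mem (hm v)
  have hl' := hl.rotate
  rw [List.cons_append] at hl'
  have hm' : ∀ u, u ∈ v :: (B ++ A) := fun u => by have := hm u; simp at this ⊢; tauto
  have hp := hg.map_perm hl'.2.1 hm'
  have hlen := hp.length_eq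
  obtain ⟨-, -, hch, hend⟩ := hl'
  generalize B ++ A = t at *
  have hp' := hp.erase 0
  rw [List.map_cons, hv, List.erase_cons_head] at hp'
  have : n - 1 = (t.map g).length := by simp at hlen ⊢; omega
  rw [searchCycle, this]
  refine canExtend_eq_true hp' ?_ ?_
  · rw [← hv, ← List.map_cons, List.isChain_map]
    exact hch.imp hr
  · intro d hd
    rw [← hv, ← List.map_cons, List.getLast?_map] at hd
    simp only [Option.mem_def, Option.map_eq_some_iff] at hd
    obtain ⟨u, hu, rfl⟩ := hd
    have := hr _ _ (hend u hu v (by simp))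
    rwa [hv] at this

lemma searchPath_eq_true {g : V → ℕ} {n : ℕ} (hg : IsLabelling g n) (hn : 2 ≤ n)
    {r : ℕ → ℕ → Bool}
    (hr : ∀ u v, G.Adj u v → r (g u) (g v) = true) {l : List V} (hl : G.IsPathList l)
    {w : V} (hm : ∀ v, v ∈ l ↔ v ≠ w) : searchPath r n (g w) = true := by
  have hp := hg.map_perm_erase hl.1 hm
  have hlen := hp.length_eq
  rw [List.length_erase_of_mem (List.mem_range.2 (hg.lt w)), List.length_range,
    List.length_map] at hlen
  rcases l with _ | ⟨c, t⟩
  · simp at hlen; omega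
  rw [searchPath, List.any_eq_true]
  refine ⟨g c, hp.subset (by simp), ?_⟩
  -- The path covers `n - 1` vertices, of which the first is already chosen.
  have : n - 2 = (t.map g).length := by simp at hlen ⊢; omega
  rw [this]
  refine canExtend_eq_true ?_ ?_ (by simp)
  · simpa using hp.erase (g c)
  · rw [← List.map_cons, List.isChain_map]
    exact hl.2.imp hr

end SimpleGraph

/-! ### Toughness, and decision trees as certificates. -/

namespace SimpleGraph

/-- If consecutive entries of a list of labels are equal or one of them is `0`, then the number of
nonzero labels exceeds the number of zeros by at most one. -/
lemma card_toFinset_erase_zero_le {l : List ℕ}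
    (h : l.IsChain fun a b => a = 0 ∨ b = 0 ∨ a = b) :
    (l.toFinset.erase 0).card ≤ l.count 0 + 1 ∧
      (l.head? = some 0 → (l.toFinset.erase 0).card ≤ l.count 0) := by
  -- The sharper bound for lists starting with `0` pays for a new class placed in front of a zero.
  induction l with
  | nil => simp
  | cons a l ih =>
    rw [List.isChain_cons] at h
    obtain ⟨ih1, ih2⟩ := ih h.2
    by_cases ha : a = 0
    · subst ha
      have e : (0 :: l).toFinset.erase 0 = l.toFinset.erase 0 := by ext; simp
      rw [e, List.count_cons_self]
      exact ⟨by omega, fun _ => ih1⟩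
    · refine ⟨?_, fun h => absurd (by simpa using h) ha⟩
      rw [List.count_cons_of_ne ha]
      rcases l with _ | ⟨b, l⟩
      · refine le_trans (Finset.card_le_card (Finset.erase_subset _ _)) (by simp)
      · rcases h.1 b (by simp) with h0 | rfl | rfl
        · exact absurd h0 ha
        · have e : (a :: 0 :: l).toFinset.erase 0 ⊆ insert a ((0 :: l).toFinset.erase 0) := by
            intro x; simp; tauto
          have := Finset.card_le_card e
          have := Finset.card_insert_le a ((0 :: l).toFinset.erase 0)
          have := ih2 rfl
          omega
        · have e : (a :: a :: l).toFinset.erase 0 = (a :: l).toFinset.erase 0 := by ext; simp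
          rw [e]; exact ih1

variable {V : Type*} {G : SimpleGraph V}

/-- Removing `z` vertices from a platypus leaves at most `z` components. -/
lemma IsPlatypus.card_image_erase_zero_le [Fintype V] [DecidableEq V] (hG : G.IsPlatypus)
    (c : V → ℕ) (hc : ∀ u v, G.Adj u v → c u = 0 ∨ c v = 0 ∨ c u = c v)
    (hpos : ∃ v, c v = 0) {m : List V} (hm : m.Nodup) (hm' : ∀ v, v ∈ m) :
    ((m.map c).toFinset.erase 0).card ≤ (m.map c).count 0 := by
  obtain ⟨v, hv⟩ := hpos
  -- The hamiltonian path of `G - v` contains one zero fewer than `m`, which absorbs the `+ 1` of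
  -- the list bound.
  obtain ⟨l, hl, hlm⟩ := hG.exists_isPathList v
  have hp : m.Perm (v :: l) := by
    rw [List.perm_ext_iff_of_nodup hm (List.nodup_cons.2 ⟨fun h => (hlm v).1 h rfl, hl.1⟩)]
    intro u
    rw [List.mem_cons, hlm]
    exact ⟨fun _ => eq_or_ne u v, fun _ => hm' u⟩
  have hp' := hp.map c
  rw [List.map_cons, hv] at hp'
  rw [List.toFinset_eq_of_perm _ _ hp', hp'.count_eq, List.count_cons_self]
  have e : (0 :: l.map c).toFinset.erase 0 = (l.map c).toFinset.erase 0 := by ext; simp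
  rw [e]
  refine (card_toFinset_erase_zero_le ?_).1
  rw [List.isChain_map]
  exact hl.2.imp hc

/-- Membership in a symmetric relation on `{0, …, 15}` stored as a bit mask. -/
def hasEdge (m i j : ℕ) : Bool := m.testBit (16 * i + j)

/-- Insertion of a pair into a symmetric relation on `{0, …, 15}` stored as a bit mask. -/
def addEdge (m i j : ℕ) : ℕ := m ||| 2 ^ (16 * i + j) ||| 2 ^ (16 * j + i)

/-- With second coordinates below `16`, the bit position `16 * i + j` determines the pair. -/
lemma hasEdge_addEdge {m i j a b : ℕ} (hi : i < 16) (hj : j < 16) (hb : b < 16)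
    (h : hasEdge (addEdge m i j) a b = true) :
    hasEdge m a b = true ∨ (a = i ∧ b = j) ∨ (a = j ∧ b = i) := by
  simp only [hasEdge, addEdge, Nat.testBit_or, Nat.testBit_two_pow, Bool.or_eq_true,
    decide_eq_true_eq] at h ⊢
  rcases h with (h | h) | h
  · exact .inl h
  · exact .inr (.inl (by omega))
  · exact .inr (.inr (by omega))

/-- The decimal digits of `t`, least significant first, cut off after `k` digits. -/
def digitList : ℕ → ℕ → List ℕ
  | 0, _ => []
  -- Leading zeros are lost, so encoded paths and cycles are written with a nonzero leading digit.
  -- Partitions and isomorphisms are read by `digitAt`, for which leading zeros do no harm.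
  | k + 1, t => if t = 0 then [] else t % 10 :: digitList k (t / 10)

/-- The decimal digit of `t` at position `i`. -/
def digitAt (t i : ℕ) : ℕ := t / 10 ^ i % 10

/-- A list without repetitions of numbers less than `n` whose consecutive entries are edges. -/
def isPathCode (m n : ℕ) : List ℕ → Bool
  | [] => true
  | [a] => Nat.blt a n
  | a :: b :: l => Nat.blt a n && hasEdge m a b && !(b :: l).elem a && isPathCode m n (b :: l)

lemma isPathCode_spec {m n : ℕ} {l : List ℕ} (h : isPathCode m n l = true) :
    (∀ i ∈ l, i < n) ∧ l.Nodup ∧ l.IsChain fun i j => hasEdge m i j = true := by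
  induction l with
  | nil => simp
  | cons a l ih =>
    rcases l with _ | ⟨b, l⟩
    · simpa [isPathCode, Nat.blt_eq] using h
    · simp only [isPathCode, Bool.and_eq_true, Nat.blt_eq, Bool.not_eq_true'] at h
      obtain ⟨h1, h2, h3⟩ := ih h.2
      refine ⟨?_, List.nodup_cons.2 ⟨?_, h2⟩, List.isChain_cons_cons.2 ⟨h.1.1.2, h3⟩⟩
      · intro i hi
        rcases List.mem_cons.1 hi with rfl | hi
        · exact h.1.1.1
        · exact h1 i hi
      · intro ha
        have := List.elem_eq_true_of_mem ha
        rw [h.1.2] at this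
        cases this

/-- A decision tree over the pairs of vertices of a labelled graph. Every leaf carries a decimally
encoded reason why the branch is closed: a long cycle, a long path, a partition of the vertices
violating toughness, a vertex whose removal leaves a non-traceable graph, or an isomorphism with a
listed graph. -/
inductive SearchTree
  | branch (i j : ℕ) (present absent : SearchTree)
  | cycle (t : ℕ)
  | path (t : ℕ)
  | cut (t : ℕ)
  | dead (w : ℕ)
  | iso (k t : ℕ)

namespace SearchTree

/-- Validity of a cycle of length at least `L`. -/
def checkCycle (n L Y : ℕ) (l : List ℕ) : Bool :=
  Nat.ble 3 l.length && Nat.ble L l.length && isPathCode Y n l &&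
    hasEdge Y (l.getLastD 0) (l.headD 0)

/-- Validity of a partition into `z` removed vertices and `z + 1` pairwise nonadjacent classes. -/
def checkCut (n N t : ℕ) : Bool :=
  let z := ((List.range n).map (digitAt t)).count 0
  Nat.blt 0 z &&
    (List.range (z + 1)).all (fun c => (List.range n).any fun i => digitAt t i == c + 1) &&
    (List.range n).all fun i => (List.range n).all fun j =>
      digitAt t i == 0 || digitAt t j == 0 || digitAt t i == digitAt t j || hasEdge N i j

/-- Validity of an isomorphism with the graph with edges `es`. -/
def checkIso (n Y N : ℕ) (es : List (ℕ × ℕ)) (t : ℕ) : Bool :=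
  (List.range n).all fun i => Nat.blt (digitAt t i) n &&
    (List.range n).all fun j => i == j || (!(digitAt t i == digitAt t j) &&
      bif es.elem (digitAt t i, digitAt t j) || es.elem (digitAt t j, digitAt t i)
        then hasEdge Y i j else hasEdge N i j)

/-- Validity of a decision tree, given the known edges `Y` and the known non-edges `N`. -/
def check (n L P : ℕ) (Ts : List (List (ℕ × ℕ))) : SearchTree → ℕ → ℕ → Bool
  | branch i j t₁ t₂, Y, N => Nat.blt i n && Nat.blt j n &&
      check n L P Ts t₁ (addEdge Y i j) N && check n L P Ts t₂ Y (addEdge N i j)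
  | cycle t, Y, _ => checkCycle n L Y (digitList n t)
  | path t, Y, _ => Nat.ble P (digitList n t).length && isPathCode Y n (digitList n t)
  | cut t, _, N => checkCut n N t
  -- Every pair not known to be a non-edge counts as an edge, so a failed search is valid for all
  -- graphs in the branch.
  | dead w, _, N => Nat.blt w n && !searchPath (fun i j => !hasEdge N i j) n w
  | iso k t, Y, N => Nat.blt k Ts.length && checkIso n Y N (Ts.getD k []) t

variable {g : V → ℕ} {n L P Y N : ℕ}

lemma exists_isCycleList (hg : IsLabelling g n) (hY : ∀ u v, hasEdge Y (g u) (g v) = true → G.Adj u v)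
    {l : List ℕ} (h : checkCycle n L Y l = true) : ∃ l', G.IsCycleList l' ∧ L ≤ l'.length := by
  simp only [checkCycle, Bool.and_eq_true, Nat.ble_eq] at h
  obtain ⟨⟨⟨h1, h2⟩, h3⟩, h4⟩ := h
  obtain ⟨h5, h6, h7⟩ := isPathCode_spec h3
  obtain ⟨l, rfl⟩ := hg.exists_map_eq h5
  rw [List.length_map] at h1 h2
  refine ⟨l, ⟨h1, h6.of_map, ?_, ?_⟩, h2⟩
  · rw [List.isChain_map] at h7
    exact h7.imp hY
  · intro a ha b hb
    simp only [Option.mem_def] at ha hb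
    refine hY a b ?_
    rw [List.getLastD_eq_getLast?, List.headD_eq_head?_getD, List.getLast?_map, List.head?_map, ha,
      hb] at h4
    simpa using h4

lemma exists_isPathList_of_isPathCode (hg : IsLabelling g n)
    (hY : ∀ u v, hasEdge Y (g u) (g v) = true → G.Adj u v)
    {l : List ℕ} (h : isPathCode Y n l = true) : ∃ l', G.IsPathList l' ∧ l'.length = l.length := by
  obtain ⟨h5, h6, h7⟩ := isPathCode_spec h
  obtain ⟨l, rfl⟩ := hg.exists_map_eq h5
  refine ⟨l, ⟨h6.of_map, ?_⟩, by simp⟩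
  rw [List.isChain_map] at h7
  exact h7.imp hY

variable [Fintype V] [DecidableEq V]

lemma checkCut_eq_false (hG : G.IsPlatypus) (hg : IsLabelling g n)
    (hN : ∀ u v, hasEdge N (g u) (g v) = true → ¬ G.Adj u v) (t : ℕ) : checkCut n N t = false := by
  rw [← Bool.not_eq_true]
  intro h
  simp only [checkCut, Bool.and_eq_true, Nat.blt_eq, List.all_eq_true, List.any_eq_true,
    List.mem_range, Bool.or_eq_true, beq_iff_eq] at h
  obtain ⟨⟨h1, h2⟩, h3⟩ := h
  have hperm := (hg.map_perm (Finset.nodup_toList (Finset.univ : Finset V)) (by simp)).map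
    (digitAt t)
  rw [List.map_map] at hperm
  have hle := hG.card_image_erase_zero_le (digitAt t ∘ g) (fun u v huv => by
    rcases h3 _ (hg.lt u) _ (hg.lt v) with ((h | h) | h) | h
    · exact .inl h
    · exact .inr (.inl h)
    · exact .inr (.inr h)
    · exact absurd huv (hN u v h)) (by
      obtain ⟨i, hi, hi0⟩ := List.mem_map.1 (List.count_pos_iff.1 h1)
      obtain ⟨v, rfl⟩ := hg.exists_eq (List.mem_range.1 hi)
      exact ⟨v, hi0⟩) (Finset.nodup_toList (Finset.univ : Finset V)) (by simp)
  rw [List.toFinset_eq_of_perm _ _ hperm, hperm.count_eq] at hle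
  set z := ((List.range n).map (digitAt t)).count 0
  -- All the classes `1, …, z + 1` occur, whereas deleting `z` vertices leaves at most `z` classes.
  have hsub : (Finset.range (z + 1)).image (· + 1) ⊆
      ((List.range n).map (digitAt t)).toFinset.erase 0 := by
    intro c hc
    obtain ⟨d, hd, rfl⟩ := Finset.mem_image.1 hc
    obtain ⟨i, hi, hid⟩ := h2 d (Finset.mem_range.1 hd)
    simp only [Finset.mem_erase, List.mem_toFinset, List.mem_map, List.mem_range]
    exact ⟨by omega, i, hi, hid⟩
  have := Finset.card_le_card hsub
  rw [Finset.card_image_of_injective _ (add_left_injective 1), Finset.card_range] at this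
  omega

/-- The digits of `t` are the images of the vertices. The check demands distinct images and that
every pair be decided in agreement with `es`; undecided pairs make it fail. -/
lemma nonempty_iso_of_checkIso (hg : IsLabelling g n) (hcard : Fintype.card V = n)
    (hY : ∀ u v, hasEdge Y (g u) (g v) = true → G.Adj u v)
    (hN : ∀ u v, hasEdge N (g u) (g v) = true → ¬ G.Adj u v)
    {es : List (ℕ × ℕ)} {t : ℕ} (h : checkIso n Y N es t = true) :
    Nonempty (G ≃g ofEdges n es) := by
  simp only [checkIso, List.all_eq_true, List.mem_range, Bool.and_eq_true, Nat.blt_eq,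
    Bool.or_eq_true, beq_iff_eq, Bool.not_eq_true', beq_eq_false_iff_ne] at h
  have hlt : ∀ v, digitAt t (g v) < n := fun v => (h _ (hg.lt v)).1
  have hpair : ∀ u v, u ≠ v → _ := fun u v huv =>
    ((h _ (hg.lt u)).2 _ (hg.lt v)).resolve_left fun e => huv (hg.injective e)
  let φ : V → Fin n := fun v => ⟨digitAt t (g v), hlt v⟩
  have hinj : Function.Injective φ := by
    intro u v huv
    by_contra hne
    exact (hpair u v hne).1 (congrArg Fin.val huv)
  have hbij : Function.Bijective φ :=
    (Fintype.bijective_iff_injective_and_card φ).2 ⟨hinj, by simp [hcard]⟩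
  refine ⟨⟨Equiv.ofBijective φ hbij, ?_⟩⟩
  intro u v
  rw [Equiv.ofBijective_apply, Equiv.ofBijective_apply]
  by_cases huv : u = v
  · subst huv; simp
  have h2 := (hpair u v huv).2
  have hφ : φ u ≠ φ v := hinj.ne huv
  change (φ u ≠ φ v ∧ ((digitAt t (g u), digitAt t (g v)) ∈ es ∨
    (digitAt t (g v), digitAt t (g u)) ∈ es)) ↔ _
  rw [← List.elem_iff, ← List.elem_iff, ← Bool.or_eq_true]
  cases hb : (es.elem (digitAt t (g u), digitAt t (g v)) ||
    es.elem (digitAt t (g v), digitAt t (g u)))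
  · rw [hb, cond_false] at h2
    simp [hN u v h2]
  · rw [hb, cond_true] at h2
    simp [hφ, hY u v h2]

/-- Soundness of the search: a platypus without cycles of length at least `L` and without paths on
at least `P` vertices that is compatible with the known edges and non-edges is isomorphic to one of
the listed graphs. -/
theorem exists_iso_of_check (hG : G.IsPlatypus) (hg : IsLabelling g n)
    (hcard : Fintype.card V = n) (hn : n ≤ 16)
    (hL : ∀ l, G.IsCycleList l → l.length < L) (hP : ∀ l, G.IsPathList l → l.length < P)
    {Ts : List (List (ℕ × ℕ))} (T : SearchTree) :
    ∀ {Y N : ℕ}, (∀ u v, hasEdge Y (g u) (g v) = true → G.Adj u v) →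
      (∀ u v, hasEdge N (g u) (g v) = true → ¬ G.Adj u v) → T.check n L P Ts Y N = true →
      ∃ es ∈ Ts, Nonempty (G ≃g ofEdges n es) := by
  have hn2 : 2 ≤ n := by have := hG.three_le_card; omega
  induction T with
  | branch i j t₁ t₂ ih₁ ih₂ =>
    intro Y N hY hN h
    simp only [check, Bool.and_eq_true, Nat.blt_eq] at h
    obtain ⟨⟨⟨hi, hj⟩, h1⟩, h2⟩ := h
    have hlt : ∀ v, g v < 16 := fun v => (hg.lt v).trans_le hn
    obtain ⟨a, ha⟩ := hg.exists_eq hi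
    obtain ⟨b, hb⟩ := hg.exists_eq hj
    by_cases hab : G.Adj a b
    · refine ih₁ (fun u v huv => ?_) hN h1
      rcases hasEdge_addEdge (by omega) (by omega) (hlt v) huv with h | h | h
      · exact hY u v h
      · rwa [hg.injective (h.1.trans ha.symm), hg.injective (h.2.trans hb.symm)]
      · rw [hg.injective (h.1.trans hb.symm), hg.injective (h.2.trans ha.symm)]
        exact hab.symm
    · refine ih₂ hY (fun u v huv => ?_) h2
      rcases hasEdge_addEdge (by omega) (by omega) (hlt v) huv with h | h | h
      · exact hN u v h
      · rwa [hg.injective (h.1.trans ha.symm), hg.injective (h.2.trans hb.symm)]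
      · rw [hg.injective (h.1.trans hb.symm), hg.injective (h.2.trans ha.symm)]
        exact fun h => hab h.symm
  | cycle t =>
    intro Y N hY hN h
    obtain ⟨l, hl, hlen⟩ := exists_isCycleList hg hY h
    exact absurd (hL l hl) (by omega)
  | path t =>
    intro Y N hY hN h
    simp only [check, Bool.and_eq_true, Nat.ble_eq] at h
    obtain ⟨l, hl, hlen⟩ := exists_isPathList_of_isPathCode hg hY h.2
    exact absurd (hP l hl) (by omega)
  | cut t =>
    intro Y N hY hN h
    rw [check, checkCut_eq_false hG hg hN] at h
    cases h
  | dead w =>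
    intro Y N hY hN h
    simp only [check, Bool.and_eq_true, Nat.blt_eq, Bool.not_eq_true'] at h
    obtain ⟨v, rfl⟩ := hg.exists_eq h.1
    obtain ⟨l, hl, hm⟩ := hG.exists_isPathList v
    rw [searchPath_eq_true hg hn2 (fun a b hab => ?_) hl hm] at h
    · cases h.2
    · by_contra hne
      exact hN a b (by simpa using hne) hab
  | iso k t =>
    intro Y N hY hN h
    simp only [check, Bool.and_eq_true, Nat.blt_eq] at h
    refine ⟨Ts.getD k [], ?_, nonempty_iso_of_checkIso hg hcard hY hN h.2⟩
    rw [List.getD_eq_getElem _ _ h.1]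
    exact List.getElem_mem _

end SearchTree
end SimpleGraph

/-! ### The four exceptional graphs and the certificate trees. -/

namespace SimpleGraph

/-- The edges of two triangles whose corresponding vertices are joined by paths of length two,
together with the first `k` of the three edges joining corresponding vertices. -/
def platypusEdges (k : ℕ) : List (ℕ × ℕ) :=
  [(0, 1), (1, 2), (0, 2), (6, 7), (7, 8), (6, 8), (0, 3), (1, 4), (2, 5), (3, 6), (4, 7), (5, 8)] ++
    [(0, 6), (1, 7), (2, 8)].take k

namespace SearchTree

/-- The edges of the path `0, 1, …, k`. -/
def pathMask : ℕ → ℕ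
  | 0 => 0
  | k + 1 => addEdge (pathMask k) k (k + 1)

/-- The case in which some cycle misses exactly the vertex `0`, for order 6. -/
def nearHamiltonianTree6 : SearchTree :=
  branch 0 2 (cycle 102345) (branch 0 5 (cycle 105432) (branch 0 3 (branch 2 4 (cycle 103245)
  (branch 2 5 (cycle 103452) (branch 0 4 (cycle 154032) (cut 220103)))) (branch 0 4 (branch 2 5
  (cycle 104325) (branch 3 5 (cycle 104532) (cut 201103))) (cut 111102))))

/-- The case in which some cycle misses exactly the vertex `0`, for order 7. -/
def nearHamiltonianTree7 : SearchTree :=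
  branch 0 2 (cycle 1023456) (branch 0 6 (cycle 1065432) (branch 0 4 (branch 2 5 (cycle 1043256)
  (branch 3 6 (cycle 1045632) (branch 0 3 (cycle 1654032) (branch 0 5 (cycle 1650432) (branch 3 5
  (branch 2 4 (cycle 1042356) (branch 2 6 (cycle 1043562) (branch 4 6 (cycle 1046532) (dead 1))))
  (branch 2 6 (branch 1 3 (cycle 1045623) (branch 1 5 (cycle 1043265) (dead 4))) (cut
  2201103))))))) (branch 0 3 (branch 2 4 (cycle 1032456) (branch 2 6 (cycle 1034562) (branch 4 6
  (branch 2 5 (cycle 1034652) (branch 0 5 (cycle 1056432) (cut 2220103))) (cut 3020104)))) (branch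
  0 5 (branch 2 6 (cycle 1054326) (branch 4 6 (cycle 1056432) (branch 2 4 (branch 3 6 (cycle
  1056342) (cut 2011103)) (cut 3020104)))) (cut 1111102)))))

/-- The case in which some cycle misses exactly the vertex `0`, for order 8. -/
def nearHamiltonianTree8 : SearchTree :=
  branch 0 2 (cycle 10234567) (branch 0 7 (cycle 10765432) (branch 0 4 (branch 2 5 (cycle
  10432567) (branch 3 7 (cycle 10456732) (branch 0 3 (cycle 17654032) (branch 0 5 (cycle 17650432)
  (branch 3 5 (branch 2 4 (cycle 10423567) (branch 2 6 (cycle 10453267) (branch 2 7 (cycle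
  10435672) (branch 4 7 (cycle 10476532) (branch 0 6 (cycle 17604532) (branch 5 7 (branch 3 6
  (cycle 10457632) (branch 4 6 (cycle 10467532) (dead 1))) (dead 1))))))) (branch 2 7 (branch 1 3
  (cycle 10456723) (branch 1 5 (cycle 10432765) (branch 3 6 (cycle 10456327) (branch 0 6 (cycle
  10654327) (branch 5 7 (branch 1 6 (cycle 10432756) (branch 2 6 (cycle 10432657) (dead 4))) (dead
  4)))))) (branch 5 7 (branch 2 6 (cycle 10432657) (branch 3 6 (cycle 10457632) (branch 0 6 (cycle
  10675432) (cut 22201103)))) (cut 30201104)))))))) (branch 0 5 (branch 2 6 (cycle 10543267)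
  (branch 4 7 (cycle 10567432) (branch 0 6 (cycle 17605432) (branch 4 6 (branch 2 5 (cycle
  10523467) (branch 2 7 (cycle 10564327) (branch 3 7 (cycle 10546732) (branch 5 7 (cycle 10576432)
  (branch 0 3 (cycle 17645032) (branch 2 4 (branch 3 5 (cycle 10532467) (branch 3 6 (cycle
  10542367) (dead 1))) (dead 1))))))) (branch 2 7 (branch 1 4 (cycle 10567234) (branch 1 6 (cycle
  10543276) (branch 3 6 (cycle 10543672) (branch 0 3 (cycle 10345672) (branch 2 4 (branch 1 3
  (cycle 10567243) (branch 3 7 (cycle 10567342) (dead 5))) (dead 5)))))) (branch 2 4 (branch 3 6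
  (cycle 10542367) (branch 3 7 (cycle 10567342) (branch 0 3 (cycle 10324567) (cut 22011103))))
  (cut 33020104))))))) (branch 0 3 (branch 2 4 (cycle 10324567) (branch 2 7 (cycle 10345672)
  (branch 2 5 (branch 2 6 (cycle 10345267) (branch 4 6 (cycle 10325467) (branch 4 7 (cycle
  10347652) (branch 0 6 (cycle 17603452) (cut 33020104))))) (branch 2 6 (branch 4 7 (cycle
  10326547) (branch 5 7 (cycle 10345762) (cut 30220104))) (branch 0 6 (branch 4 7 (cycle 17456032)
  (branch 5 7 (cycle 10675432) (cut 30220104))) (cut 22220103)))))) (branch 0 6 (branch 2 7 (cycle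
  10654327) (branch 5 7 (cycle 10675432) (branch 3 7 (branch 2 4 (cycle 10654237) (branch 2 5
  (cycle 10673452) (branch 4 7 (cycle 10654732) (cut 30220104)))) (branch 4 7 (branch 2 5 (cycle
  10652347) (branch 3 5 (cycle 10674532) (cut 30201104))) (cut 20111103))))) (cut 11111102))))))

/-- The case in which some cycle misses exactly the vertex `0`, for order 9. -/
def nearHamiltonianTree9 : SearchTree :=
  branch 0 2 (cycle 102345678) (branch 0 8 (cycle 108765432) (branch 0 4 (branch 2 5 (cycle
  104325678) (branch 3 8 (cycle 104567832) (branch 0 3 (cycle 187654032) (branch 0 5 (cycle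
  187650432) (branch 3 5 (branch 2 4 (cycle 104235678) (branch 2 6 (cycle 104532678) (branch 2 8
  (cycle 104356782) (branch 4 8 (cycle 104876532) (branch 0 6 (cycle 187604532) (branch 2 7
  (branch 3 6 (cycle 104563278) (branch 4 6 (cycle 104653278) (branch 5 8 (cycle 104327658)
  (branch 6 8 (cycle 104356872) (dead 1))))) (branch 0 7 (branch 3 6 (cycle 187045632) (branch 4 6
  (cycle 187046532) (branch 5 8 (cycle 185670432) (branch 6 8 (cycle 107865432) (dead 1)))))
  (branch 5 8 (branch 3 6 (cycle 104587632) (branch 4 6 (cycle 104678532) (branch 6 8 (branch 3 7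
  (cycle 104568732) (branch 4 7 (cycle 104786532) (dead 1))) (dead 1)))) (branch 6 8 (branch 3 7
  (cycle 104568732) (branch 4 7 (cycle 104786532) (branch 5 7 (branch 3 6 (cycle 104578632)
  (branch 4 6 (cycle 104687532) (dead 1))) (dead 1)))) (dead 1)))))))))) (branch 5 8 (branch 3 6
  (cycle 104587632) (branch 2 7 (cycle 104327658) (branch 0 6 (cycle 106785432) (branch 0 7 (cycle
  185670432) (branch 3 7 (branch 2 4 (cycle 104237658) (branch 2 6 (cycle 104562378) (branch 4 6
  (cycle 104658732) (branch 2 8 (cycle 104567328) (branch 4 8 (cycle 104856732) (branch 6 8 (cycle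
  104568732) (dead 1))))))) (branch 2 6 (branch 1 3 (cycle 104587623) (branch 1 5 (cycle
  104326785) (branch 1 7 (cycle 104326587) (branch 5 7 (cycle 104326578) (dead 4))))) (branch 2 8
  (branch 1 3 (cycle 104567823) (branch 1 5 (cycle 104328765) (branch 1 7 (cycle 104328567)
  (branch 1 6 (branch 5 7 (cycle 104328756) (dead 4)) (dead 4))))) (cut 222201103)))))))) (branch
  2 8 (branch 1 3 (cycle 104567823) (branch 1 5 (cycle 104328765) (branch 3 7 (cycle 104567328)
  (branch 0 7 (cycle 107654328) (branch 5 7 (branch 1 6 (cycle 104328756) (branch 2 6 (cycle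
  104326578) (branch 3 6 (cycle 104365782) (branch 0 6 (cycle 187560432) (branch 6 8 (branch 1 7
  (cycle 104328657) (branch 2 7 (cycle 104327568) (dead 4))) (dead 4)))))) (branch 3 6 (branch 1 7
  (cycle 104563287) (branch 2 7 (cycle 104563278) (dead 4))) (branch 0 6 (branch 1 7 (cycle
  106543287) (branch 2 7 (cycle 106543278) (dead 4))) (dead 4)))))))) (branch 0 6 (branch 2 7
  (cycle 106543278) (branch 5 7 (cycle 187560432) (branch 0 7 (cycle 187065432) (branch 3 7
  (branch 2 4 (cycle 106542378) (branch 2 6 (cycle 104562378) (branch 4 8 (cycle 106548732)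
  (branch 6 8 (cycle 104568732) (dead 1))))) (cut 330201104))))) (branch 2 6 (branch 3 7 (cycle
  104562378) (branch 5 7 (cycle 104326578) (branch 0 7 (branch 1 3 (cycle 187045623) (branch 1 5
  (cycle 187043265) (branch 3 6 (cycle 187045632) (branch 6 8 (cycle 107865432) (dead 4)))))
  (branch 2 7 (branch 3 6 (cycle 104563278) (branch 6 8 (branch 1 3 (cycle 104568723) (branch 1 5
  (cycle 104327865) (dead 4))) (dead 1))) (cut 330201104))))) (branch 3 6 (branch 2 7 (cycle
  104563278) (branch 0 7 (cycle 187045632) (branch 5 7 (branch 2 4 (cycle 104236578) (branch 4 8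
  (cycle 104875632) (branch 6 8 (cycle 104578632) (dead 1)))) (branch 3 7 (branch 6 8 (cycle
  104568732) (dead 1)) (cut 330201104))))) (branch 6 8 (branch 3 7 (cycle 104568732) (branch 0 7
  (cycle 107865432) (branch 2 7 (branch 1 3 (cycle 104568723) (branch 1 5 (cycle 104327865)
  (branch 5 7 (cycle 104327568) (dead 4)))) (cut 222201103)))) (cut 302201104)))))))))))) (branch
  0 6 (branch 2 7 (cycle 106543278) (branch 5 8 (cycle 106785432) (branch 0 5 (cycle 187605432)
  (branch 0 7 (cycle 187065432) (branch 2 8 (branch 1 5 (cycle 106782345) (branch 1 7 (cycle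
  106543287) (branch 3 7 (cycle 106543782) (branch 5 7 (cycle 106754328) (branch 0 3 (cycle
  103456782) (branch 4 7 (branch 1 3 (cycle 106547823) (branch 2 5 (cycle 106523478) (branch 3 5
  (cycle 106534782) (branch 3 8 (cycle 106547832) (dead 4))))) (branch 2 5 (branch 1 3 (cycle
  106782543) (branch 3 8 (cycle 106783452) (branch 3 5 (branch 1 4 (cycle 106782354) (branch 4 8
  (cycle 106784532) (dead 6))) (dead 6)))) (branch 3 5 (branch 1 4 (cycle 106782354) (branch 4 8
  (cycle 106784532) (branch 2 4 (branch 1 3 (cycle 106782453) (branch 3 8 (cycle 106783542) (dead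
  6))) (dead 6)))) (dead 6))))))))) (branch 2 5 (branch 4 7 (cycle 106523478) (branch 3 8 (cycle
  106783452) (branch 0 3 (cycle 187603452) (branch 4 8 (branch 1 3 (cycle 106784523) (branch 1 5
  (cycle 106784325) (branch 3 5 (cycle 106784532) (branch 1 7 (cycle 106523487) (branch 3 7 (cycle
  106548732) (branch 5 7 (cycle 106578432) (dead 6))))))) (branch 3 7 (branch 2 4 (cycle
  106542378) (branch 2 6 (cycle 106254378) (branch 4 6 (cycle 106452378) (branch 6 8 (cycle
  106873452) (dead 1))))) (branch 5 7 (branch 2 6 (cycle 106234578) (branch 4 6 (cycle 106432578)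
  (branch 6 8 (cycle 106875432) (branch 2 4 (branch 3 6 (cycle 106324578) (dead 1)) (dead 1)))))
  (cut 220111103))))))) (branch 5 7 (branch 2 6 (cycle 106234578) (branch 4 8 (cycle 106578432)
  (branch 6 8 (cycle 106875432) (branch 2 4 (branch 3 6 (cycle 106324578) (branch 3 7 (cycle
  106542378) (branch 3 8 (cycle 106578342) (branch 0 3 (cycle 103245678) (branch 3 5 (branch 4 6
  (cycle 106423578) (branch 4 7 (cycle 106532478) (dead 1))) (dead 1)))))) (branch 4 6 (branch 3 8
  (cycle 106457832) (branch 0 3 (cycle 187546032) (dead 1))) (branch 4 7 (branch 3 8 (cycle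
  106547832) (branch 0 3 (cycle 187456032) (dead 1))) (dead 1))))))) (branch 2 4 (branch 3 7
  (cycle 106542378) (branch 0 3 (cycle 103245678) (branch 3 8 (branch 1 5 (cycle 106783245)
  (branch 3 5 (cycle 106783542) (branch 1 7 (cycle 106542387) (branch 4 7 (cycle 106547832) (dead
  6))))) (branch 3 5 (branch 4 7 (cycle 106532478) (branch 4 8 (cycle 106784532) (cut 220111103)))
  (cut 330201104))))) (branch 4 7 (branch 3 8 (cycle 106547832) (branch 0 3 (cycle 187456032)
  (branch 3 5 (branch 2 6 (cycle 106235478) (branch 4 8 (cycle 106784532) (branch 6 8 (cycle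
  106874532) (dead 1)))) (branch 3 7 (branch 4 8 (cycle 106548732) (dead 1)) (cut 330201104)))))
  (branch 4 8 (branch 3 5 (cycle 106784532) (branch 3 7 (cycle 106548732) (branch 0 3 (branch 1 5
  (cycle 154876032) (branch 1 7 (cycle 178456032) (dead 6))) (dead 1)))) (cut 330220104)))))))))))
  (branch 0 5 (branch 2 6 (cycle 105432678) (branch 4 8 (cycle 105678432) (branch 4 6 (branch 2 5
  (cycle 105234678) (branch 2 7 (cycle 105643278) (branch 3 8 (cycle 105467832) (branch 5 8 (cycle
  105876432) (branch 0 3 (cycle 187645032) (branch 0 7 (cycle 187056432) (branch 2 8 (branch 1 3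
  (cycle 105467823) (branch 1 4 (cycle 105678234) (branch 3 5 (cycle 105346782) (branch 1 6 (cycle
  105432876) (branch 3 6 (cycle 105436782) (branch 1 7 (cycle 105643287) (branch 3 7 (cycle
  105643782) (branch 4 7 (cycle 105674328) (branch 5 7 (cycle 105764328) (branch 2 4 (branch 1 5
  (branch 6 8 (iso 3 258674103) (iso 2 258674103)) (branch 6 8 (iso 2 147863025) (iso 1
  258763014))) (branch 1 5 (branch 6 8 (iso 2 147685203) (iso 1 258674103)) (branch 6 8 (iso 1
  36785214) (iso 0 258674103))))))))))))) (branch 2 4 (branch 3 5 (cycle 105324678) (branch 3 6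
  (cycle 105423678) (branch 3 7 (cycle 105642378) (branch 6 8 (branch 4 7 (cycle 105687432)
  (branch 5 7 (cycle 105786432) (dead 1))) (dead 1))))) (branch 6 8 (branch 3 7 (cycle 105468732)
  (branch 4 7 (cycle 105687432) (branch 5 7 (cycle 105786432) (dead 1)))) (dead 1))))))))))
  (branch 2 8 (branch 1 4 (cycle 105678234) (branch 1 6 (cycle 105432876) (branch 3 6 (cycle
  105436782) (branch 4 7 (cycle 105674328) (branch 0 3 (cycle 103456782) (branch 0 7 (cycle
  107654328) (branch 2 4 (branch 1 3 (cycle 105678243) (branch 3 7 (cycle 105673428) (branch 3 8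
  (cycle 105678342) (branch 6 8 (branch 1 7 (cycle 105432867) (branch 2 7 (cycle 105432768) (dead
  5))) (dead 5))))) (branch 6 8 (branch 1 7 (cycle 105432867) (branch 2 7 (cycle 105432768)
  (branch 3 7 (cycle 105437682) (dead 5)))) (dead 5))))))))) (branch 2 4 (branch 3 6 (cycle
  105423678) (branch 3 8 (cycle 105678342) (branch 0 3 (cycle 103245678) (branch 6 8 (branch 2 7
  (cycle 105432768) (branch 3 7 (cycle 105687342) (branch 4 7 (cycle 105687432) (branch 0 7 (cycle
  107865432) (cut 222011103))))) (cut 302011104))))) (branch 6 8 (branch 2 7 (cycle 105432768)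
  (branch 4 7 (cycle 105687432) (branch 0 7 (cycle 107865432) (cut 333020104)))) (cut
  403020105))))))) (branch 0 3 (branch 2 4 (cycle 103245678) (branch 2 8 (cycle 103456782) (branch
  2 6 (branch 2 5 (cycle 103452678) (branch 2 7 (cycle 103456278) (branch 4 7 (cycle 103265478)
  (branch 5 8 (cycle 103458762) (branch 0 7 (cycle 187034562) (branch 4 8 (branch 1 5 (cycle
  103267845) (branch 3 5 (cycle 103548762) (branch 1 7 (cycle 103265487) (branch 3 7 (cycle
  103784562) (branch 5 7 (cycle 103487562) (dead 6)))))) (branch 5 7 (branch 4 6 (cycle 103264578)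
  (branch 6 8 (cycle 103457862) (dead 1))) (cut 330220104)))))))) (branch 4 8 (branch 2 5 (cycle
  103487652) (branch 2 7 (cycle 103276548) (branch 0 7 (cycle 184567032) (cut 222220103))))
  (branch 6 8 (branch 2 7 (cycle 103456872) (branch 0 7 (cycle 107865432) (branch 2 5 (branch 4 6
  (cycle 103254678) (branch 4 7 (cycle 103478652) (cut 333020104))) (cut 222220103)))) (branch 4 6
  (branch 2 5 (cycle 103254678) (branch 5 8 (branch 2 7 (cycle 103465872) (branch 0 7 (cycle
  107856432) (cut 222220103))) (cut 302220104))) (cut 403020105))))))) (branch 0 7 (branch 2 8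
  (cycle 107654328) (branch 6 8 (cycle 107865432) (branch 4 8 (branch 2 5 (cycle 107652348)
  (branch 3 6 (cycle 107845632) (branch 3 8 (cycle 107654832) (branch 5 8 (cycle 107658432)
  (branch 2 6 (branch 1 3 (cycle 107845623) (branch 1 5 (cycle 107843265) (branch 3 5 (cycle
  107843562) (branch 3 7 (cycle 107326548) (branch 5 7 (cycle 107562348) (dead 4)))))) (branch 3 5
  (branch 2 4 (cycle 107653248) (branch 4 6 (cycle 107846532) (dead 1))) (cut 302201104)))))))
  (branch 3 8 (branch 2 4 (cycle 107654238) (branch 2 6 (cycle 107834562) (branch 4 6 (branch 2 5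
  (cycle 107834652) (branch 5 8 (cycle 107856432) (cut 302220104))) (cut 403020105)))) (branch 5 8
  (branch 2 6 (cycle 107623458) (branch 4 6 (cycle 107856432) (branch 2 4 (branch 3 6 (cycle
  107856342) (cut 302011104)) (cut 403020105)))) (cut 201111103)))))) (cut 111111102)))))))

/-- The traceable case without a cycle missing exactly one vertex, for order 6. -/
def traceableTree6 : SearchTree :=
  branch 1 5 (cycle 15432) (branch 0 4 (cycle 10432) (branch 0 5 (cycle 105432) (branch 2 5
  (branch 1 3 (cycle 13452) (branch 0 3 (cycle 103452) (branch 1 4 (branch 3 5 (cycle 14532) (cut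
  302011)) (cut 222011)))) (branch 3 5 (branch 1 4 (cycle 14532) (branch 2 4 (branch 1 3 (cycle
  13542) (branch 0 3 (cycle 10342) (cut 222011))) (cut 220111))) (cut 201111)))))

/-- The traceable case without a cycle missing exactly one vertex, for order 7. -/
def traceableTree7 : SearchTree :=
  branch 1 6 (cycle 165432) (branch 0 5 (cycle 105432) (branch 0 6 (cycle 1065432) (branch 2 6
  (branch 1 3 (cycle 134562) (branch 0 3 (cycle 1034562) (branch 0 4 (cycle 104562) (branch 0 2
  (branch 1 4 (cycle 102654) (branch 1 5 (cycle 102345) (cut 2222011))) (cut 1111102))))) (branch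
  3 6 (branch 1 4 (cycle 145632) (branch 0 4 (cycle 1045632) (branch 2 4 (branch 1 3 (cycle
  136542) (branch 1 5 (cycle 156342) (branch 0 3 (cycle 1036542) (cut 2222011)))) (branch 4 6
  (branch 1 5 (cycle 156432) (branch 2 5 (branch 1 3 (cycle 134652) (branch 0 3 (cycle 103452)
  (cut 2222011))) (cut 2220111))) (cut 3020111))))) (branch 4 6 (branch 1 5 (cycle 156432) (branch
  2 5 (branch 1 3 (cycle 134652) (branch 0 3 (cycle 103452) (branch 3 5 (branch 1 4 (cycle 146532)
  (branch 0 4 (cycle 104532) (cut 2222011))) (cut 3302011)))) (branch 3 5 (branch 1 4 (cycle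
  146532) (branch 0 4 (cycle 104532) (branch 2 4 (branch 1 3 (cycle 135642) (branch 0 3 (cycle
  103542) (cut 2222011))) (cut 2220111)))) (cut 2201111)))) (cut 2011111))))))

/-- The traceable case without a cycle missing exactly one vertex, for order 8. -/
def traceableTree8 : SearchTree :=
  branch 1 7 (cycle 1765432) (branch 0 6 (cycle 1065432) (branch 0 7 (cycle 10765432) (branch 2 7
  (branch 1 3 (cycle 1345672) (branch 0 3 (cycle 10345672) (branch 0 4 (cycle 1045672) (branch 0 5
  (branch 1 4 (cycle 10567234) (branch 1 6 (cycle 10543276) (branch 3 6 (cycle 10543672) (branch 4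
  6 (cycle 1056432) (branch 3 7 (cycle 1056732) (branch 4 7 (cycle 10567432) (cut 33022011)))))))
  (branch 0 2 (branch 1 4 (cycle 1027654) (branch 1 6 (cycle 1023456) (branch 1 5 (branch 3 6
  (cycle 1543672) (branch 4 6 (cycle 1023465) (branch 3 7 (cycle 1023765) (branch 4 7 (cycle
  1567432) (cut 33022011))))) (cut 22222011)))) (cut 11111102)))))) (branch 3 7 (branch 1 4 (cycle
  1456732) (branch 0 4 (cycle 10456732) (branch 0 5 (cycle 1056732) (branch 0 3 (branch 2 4 (cycle
  10376542) (branch 2 5 (cycle 1037652) (branch 2 6 (cycle 1034562) (branch 0 2 (branch 1 5 (cycle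
  1023765) (branch 1 6 (cycle 1023456) (cut 22220111))) (cut 22220103))))) (branch 0 2 (branch 1 5
  (cycle 1023765) (branch 1 6 (cycle 1023456) (branch 1 3 (branch 2 4 (cycle 1376542) (branch 2 5
  (cycle 1025673) (branch 2 6 (cycle 1026543) (cut 22220111)))) (cut 22222011)))) (cut
  11111102)))))) (branch 4 7 (branch 1 5 (cycle 1567432) (branch 0 5 (cycle 10567432) (branch 2 5
  (branch 1 3 (cycle 1347652) (branch 0 3 (cycle 10347652) (branch 0 4 (cycle 1047652) (branch 0 2
  (branch 1 4 (cycle 1025674) (branch 1 6 (cycle 1023456) (cut 22222011))) (cut 11111102)))))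
  (branch 3 5 (branch 1 4 (cycle 1476532) (branch 1 6 (cycle 1674532) (branch 0 4 (cycle 10476532)
  (branch 0 3 (branch 2 4 (cycle 10356742) (branch 2 6 (cycle 1034562) (cut 22220111))) (branch 1
  3 (branch 2 4 (cycle 1356742) (branch 2 6 (cycle 1354762) (cut 22220111))) (cut 22222011))))))
  (branch 5 7 (branch 1 6 (cycle 1675432) (branch 2 6 (branch 1 3 (cycle 1345762) (branch 0 3
  (cycle 1034562) (branch 3 6 (branch 1 4 (cycle 1457632) (branch 0 4 (cycle 1045632) (cut
  22222011))) (cut 33302011)))) (branch 3 6 (branch 1 4 (cycle 1457632) (branch 0 4 (cycle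
  1045632) (branch 2 4 (branch 1 3 (cycle 1367542) (branch 0 3 (cycle 1036542) (cut 22222011)))
  (cut 22220111)))) (cut 22201111)))) (cut 30201111)))))) (branch 5 7 (branch 1 6 (cycle 1675432)
  (branch 2 6 (branch 1 3 (cycle 1345762) (branch 0 3 (cycle 1034562) (branch 0 4 (cycle 1045762)
  (branch 0 5 (branch 1 4 (cycle 1056234) (branch 3 6 (cycle 1057632) (branch 4 6 (cycle 1056432)
  (cut 33022011)))) (branch 0 2 (branch 1 4 (cycle 1026754) (branch 1 5 (branch 3 6 (cycle
  1023675) (branch 4 6 (cycle 1576432) (cut 33022011))) (cut 22222011))) (cut 11111102))))))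
  (branch 3 6 (branch 1 4 (cycle 1457632) (branch 0 4 (cycle 1045632) (branch 0 5 (cycle 1057632)
  (branch 2 4 (branch 1 3 (cycle 1367542) (branch 1 5 (cycle 1576342) (branch 0 3 (cycle 1036542)
  (cut 22222011)))) (branch 4 6 (branch 1 5 (cycle 1576432) (branch 2 5 (branch 1 3 (cycle
  1346752) (branch 0 3 (cycle 1034652) (cut 22222011))) (cut 22220111))) (cut 33020111))))))
  (branch 4 6 (branch 1 5 (cycle 1576432) (branch 0 5 (cycle 1056432) (branch 2 5 (branch 1 3
  (cycle 1346752) (branch 0 3 (cycle 1034652) (branch 3 5 (branch 1 4 (cycle 1467532) (branch 0 4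
  (cycle 1046532) (cut 22222011))) (cut 33302011)))) (branch 3 5 (branch 1 4 (cycle 1467532)
  (branch 0 4 (cycle 1046532) (branch 2 4 (branch 1 3 (cycle 1357642) (branch 0 3 (cycle 1035642)
  (cut 22222011))) (cut 22220111)))) (cut 22201111))))) (cut 22011111))))) (cut 20111111)))))))

/-- The traceable case without a cycle missing exactly one vertex, for order 9. -/
def traceableTree9 : SearchTree :=
  branch 1 8 (cycle 18765432) (branch 0 7 (cycle 10765432) (branch 0 8 (cycle 108765432) (branch 4
  8 (branch 1 5 (cycle 15678432) (branch 0 5 (cycle 105678432) (branch 0 6 (cycle 10678432)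
  (branch 0 4 (branch 2 5 (cycle 10487652) (branch 3 5 (cycle 104876532) (branch 3 6 (cycle
  10487632) (branch 3 7 (cycle 10456732) (branch 2 8 (cycle 10456782) (branch 3 8 (cycle
  104567832) (branch 1 7 (branch 5 8 (cycle 17658432) (branch 6 8 (cycle 17865432) (branch 0 2
  (cycle 10234567) (branch 0 3 (cycle 17654032) (branch 2 6 (branch 1 3 (cycle 10487623) (dead 4))
  (cut 302201104)))))) (branch 1 6 (branch 5 7 (cycle 16578432) (branch 5 8 (cycle 16785432)
  (branch 2 7 (branch 1 3 (cycle 10456723) (branch 0 3 (cycle 10345672) (cut 440302011))) (cut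
  330201111)))) (branch 2 6 (branch 1 3 (cycle 10487623) (branch 0 3 (cycle 10348762) (cut
  333302011))) (branch 2 7 (branch 1 3 (cycle 10456723) (branch 0 3 (cycle 10345672) (cut
  333302011))) (cut 222201111))))))))))) (branch 0 3 (branch 2 5 (cycle 103487652) (branch 2 6
  (cycle 10348762) (branch 2 7 (cycle 10345672) (branch 2 8 (cycle 103456782) (branch 2 4 (branch
  3 5 (cycle 103567842) (branch 1 6 (cycle 10324876) (branch 3 6 (cycle 10367842) (branch 1 7
  (cycle 10324567) (branch 3 7 (cycle 10376542) (branch 3 8 (cycle 103876542) (cut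
  222201111))))))) (branch 0 2 (branch 1 6 (cycle 10234876) (branch 1 7 (cycle 10234567) (branch 1
  4 (branch 3 5 (cycle 14876532) (branch 3 6 (cycle 10236784) (branch 3 7 (cycle 10237654) (branch
  3 8 (cycle 14567832) (cut 222201111))))) (cut 222220111)))) (cut 222220103))))))) (branch 0 2
  (branch 1 6 (cycle 10234876) (branch 1 7 (cycle 10234567) (branch 1 4 (branch 2 5 (cycle
  10256784) (branch 3 5 (cycle 14876532) (branch 3 6 (cycle 10236784) (branch 3 7 (cycle 10237654)
  (branch 2 8 (cycle 10287654) (branch 3 8 (cycle 14567832) (branch 1 3 (branch 2 6 (cycle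
  10267843) (branch 2 7 (cycle 10276543) (cut 222201111))) (cut 333302011)))))))) (branch 1 3
  (branch 2 5 (cycle 13487652) (branch 2 6 (cycle 10267843) (branch 2 7 (cycle 10276543) (branch 2
  8 (cycle 13456782) (branch 2 4 (branch 3 5 (cycle 13567842) (branch 3 6 (cycle 10248763) (branch
  3 7 (cycle 10245673) (branch 3 8 (cycle 13876542) (cut 222201111))))) (cut 222220111)))))) (cut
  222222011))))) (cut 111111102))))))) (branch 2 8 (branch 1 3 (cycle 13456782) (branch 0 3 (cycle
  103456782) (branch 0 4 (cycle 10456782) (branch 0 5 (branch 1 4 (cycle 105678234) (branch 1 6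
  (cycle 105432876) (branch 3 6 (cycle 105436782) (branch 4 6 (cycle 10546782) (branch 1 7 (cycle
  10543287) (branch 3 7 (cycle 10543782) (branch 4 7 (cycle 10567432) (branch 3 8 (cycle 10567832)
  (branch 0 6 (cycle 28760543) (cut 333022011)))))))))) (branch 0 6 (branch 1 4 (cycle 10678234)
  (branch 1 5 (cycle 106782345) (branch 1 7 (cycle 106543287) (branch 3 7 (cycle 106543782)
  (branch 4 7 (cycle 10654782) (branch 5 7 (cycle 10675432) (branch 3 8 (cycle 10654382) (branch 5
  8 (cycle 106785432) (cut 330222011))))))))) (branch 0 2 (branch 1 4 (cycle 10287654) (branch 1 7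
  (cycle 10234567) (branch 1 5 (branch 1 6 (cycle 16782345) (branch 3 6 (cycle 15436782) (branch 4
  6 (cycle 10287645) (branch 3 7 (cycle 10287345) (branch 4 7 (cycle 10234765) (branch 3 8 (cycle
  10238765) (cut 333022011))))))) (branch 1 6 (branch 3 7 (cycle 16543782) (branch 4 7 (cycle
  10287456) (branch 5 7 (cycle 10234576) (branch 3 8 (cycle 10283456) (branch 5 8 (cycle 16785432)
  (cut 330222011)))))) (cut 222222011))))) (cut 111111102))))))) (branch 3 8 (branch 1 4 (cycle
  14567832) (branch 0 4 (cycle 104567832) (branch 0 5 (cycle 10567832) (branch 0 6 (branch 2 4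
  (cycle 10678342) (branch 1 5 (cycle 10678345) (branch 2 5 (cycle 106783452) (branch 1 7 (cycle
  10654387) (branch 2 7 (cycle 106543872) (branch 4 7 (cycle 106547832) (branch 5 7 (cycle
  10675432) (branch 5 8 (cycle 106785432) (cut 330220111))))))))) (branch 0 3 (branch 2 4 (cycle
  103876542) (branch 2 5 (cycle 10387652) (branch 2 7 (cycle 10345672) (branch 2 6 (branch 1 5
  (cycle 15438762) (branch 1 7 (cycle 17834562) (branch 4 7 (cycle 103874562) (branch 5 7 (cycle
  10345762) (branch 5 8 (cycle 103458762) (cut 330220111)))))) (branch 0 2 (branch 1 5 (cycle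
  10238765) (branch 1 7 (cycle 10234567) (branch 1 6 (branch 4 7 (cycle 16547832) (branch 5 7
  (cycle 10234576) (branch 5 8 (cycle 16785432) (cut 330220111)))) (cut 222220111)))) (cut
  222220103)))))) (branch 0 2 (branch 1 5 (cycle 10238765) (branch 1 7 (cycle 10234567) (branch 1
  6 (branch 2 4 (cycle 10243876) (branch 2 5 (cycle 16783452) (branch 2 7 (cycle 16543872) (branch
  4 7 (cycle 16547832) (branch 5 7 (cycle 10234576) (branch 5 8 (cycle 16785432) (cut
  330220111))))))) (branch 1 3 (branch 2 4 (cycle 13876542) (branch 2 5 (cycle 10256783) (branch 2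
  7 (cycle 10276543) (branch 2 6 (branch 4 7 (cycle 13874562) (branch 5 7 (cycle 10267543) (branch
  5 8 (cycle 13458762) (cut 330220111)))) (cut 222220111))))) (cut 222222011))))) (cut
  111111102))))))) (branch 5 8 (branch 1 6 (cycle 16785432) (branch 0 6 (cycle 106785432) (branch
  2 6 (branch 1 3 (cycle 13458762) (branch 0 3 (cycle 103458762) (branch 0 4 (cycle 10458762)
  (branch 0 5 (branch 1 4 (cycle 105876234) (branch 3 6 (cycle 10587632) (branch 4 6 (cycle
  105876432) (branch 1 7 (cycle 10543267) (branch 3 7 (cycle 10543762) (branch 4 7 (cycle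
  10567432) (cut 333022011))))))) (branch 0 2 (branch 1 4 (cycle 10267854) (branch 1 7 (cycle
  10234567) (branch 1 5 (branch 3 6 (cycle 10236785) (branch 4 6 (cycle 15876432) (branch 3 7
  (cycle 10267345) (branch 4 7 (cycle 10234765) (cut 333022011))))) (cut 222222011)))) (cut
  111111102)))))) (branch 3 6 (branch 1 4 (cycle 14587632) (branch 0 4 (cycle 104587632) (branch 0
  5 (cycle 10587632) (branch 0 3 (branch 2 4 (cycle 103678542) (branch 2 5 (cycle 10367852)
  (branch 2 7 (cycle 10345672) (branch 0 2 (branch 1 5 (cycle 10236785) (branch 1 7 (cycle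
  10234567) (cut 222220111))) (cut 222220103))))) (branch 0 2 (branch 1 5 (cycle 10236785) (branch
  1 7 (cycle 10234567) (branch 1 3 (branch 2 4 (cycle 13678542) (branch 2 5 (cycle 10258763)
  (branch 2 7 (cycle 10276543) (cut 222220111)))) (cut 222222011)))) (cut 111111102)))))) (branch
  4 6 (branch 1 5 (cycle 15876432) (branch 1 7 (cycle 17856432) (branch 0 5 (cycle 105876432)
  (branch 0 4 (branch 2 5 (cycle 10467852) (branch 3 5 (cycle 104678532) (branch 2 7 (cycle
  10465872) (branch 3 7 (cycle 10456732) (cut 222201111))))) (branch 0 3 (branch 2 5 (cycle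
  103467852) (branch 2 7 (cycle 10345672) (branch 2 4 (branch 3 5 (cycle 103587642) (branch 3 7
  (cycle 10376542) (cut 222201111))) (branch 1 4 (branch 3 5 (cycle 14678532) (branch 3 7 (cycle
  14658732) (cut 222201111))) (cut 222220111))))) (branch 0 2 (branch 1 4 (branch 2 5 (cycle
  10258764) (branch 3 5 (cycle 14678532) (branch 2 7 (cycle 10278564) (branch 3 7 (cycle 10237654)
  (cut 222201111))))) (branch 1 3 (branch 2 5 (cycle 13467852) (branch 2 7 (cycle 10276543)
  (branch 2 4 (branch 3 5 (cycle 13587642) (branch 3 7 (cycle 10245673) (cut 222201111))) (cut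
  222220111)))) (cut 222222011))) (cut 111111102))))))) (branch 6 8 (branch 1 7 (cycle 17865432)
  (branch 2 7 (branch 1 3 (cycle 13456872) (branch 0 3 (cycle 10345672) (branch 0 4 (cycle
  10456872) (branch 0 5 (branch 1 4 (cycle 10567234) (branch 3 7 (cycle 10568732) (branch 4 7
  (cycle 10567432) (cut 333022011)))) (branch 0 2 (branch 1 4 (cycle 10278654) (branch 1 5 (branch
  3 7 (cycle 10237865) (branch 4 7 (cycle 15687432) (cut 333022011))) (cut 222222011))) (cut
  111111102)))))) (branch 3 7 (branch 1 4 (cycle 14568732) (branch 0 4 (cycle 10456732) (branch 0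
  5 (cycle 10568732) (branch 2 4 (branch 1 3 (cycle 13786542) (branch 1 5 (cycle 15687342) (branch
  0 3 (cycle 10376542) (cut 222222011)))) (branch 4 7 (branch 1 5 (cycle 15687432) (branch 2 5
  (branch 1 3 (cycle 13478652) (branch 0 3 (cycle 10347652) (cut 222222011))) (cut 222220111)))
  (cut 333020111)))))) (branch 4 7 (branch 1 5 (cycle 15687432) (branch 0 5 (cycle 10567432)
  (branch 2 5 (branch 1 3 (cycle 13478652) (branch 0 3 (cycle 10347652) (branch 3 5 (branch 1 4
  (cycle 14786532) (branch 0 4 (cycle 10476532) (cut 222222011))) (cut 333302011)))) (branch 3 5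
  (branch 1 4 (cycle 14786532) (branch 0 4 (cycle 10476532) (branch 2 4 (branch 1 3 (cycle
  13568742) (branch 0 3 (cycle 10356742) (cut 222222011))) (cut 222220111)))) (cut 222201111)))))
  (cut 222011111))))) (cut 302011111))))))) (branch 6 8 (branch 1 7 (cycle 17865432) (branch 2 7
  (branch 1 3 (cycle 13456872) (branch 0 3 (cycle 10345672) (branch 0 4 (cycle 10456872) (branch 0
  5 (branch 1 4 (cycle 10567234) (branch 1 6 (cycle 10543276) (branch 3 6 (cycle 10543672) (branch
  4 6 (cycle 10546872) (branch 3 7 (cycle 10568732) (branch 4 7 (cycle 10567432) (branch 0 6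
  (cycle 27860543) (cut 333022011)))))))) (branch 0 6 (branch 1 4 (cycle 10687234) (branch 1 5
  (cycle 10672345) (branch 3 7 (cycle 10654372) (branch 4 7 (cycle 10687432) (branch 5 7 (cycle
  10675432) (cut 330222011)))))) (branch 0 2 (branch 1 4 (cycle 10278654) (branch 1 5 (branch 1 6
  (cycle 16872345) (branch 3 6 (cycle 15436872) (branch 4 6 (cycle 10278645) (branch 3 7 (cycle
  10237865) (branch 4 7 (cycle 15687432) (cut 333022011)))))) (branch 1 6 (branch 3 7 (cycle
  10273456) (branch 4 7 (cycle 10234786) (branch 5 7 (cycle 16875432) (cut 330222011)))) (cut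
  222222011)))) (cut 111111102))))))) (branch 3 7 (branch 1 4 (cycle 14568732) (branch 0 4 (cycle
  10456732) (branch 0 5 (cycle 10568732) (branch 1 5 (branch 2 4 (cycle 15687342) (branch 2 6
  (cycle 15437862) (branch 4 6 (cycle 15468732) (branch 4 7 (cycle 15687432) (branch 0 2 (cycle
  10237865) (branch 0 6 (cycle 10687345) (cut 333020104))))))) (branch 0 6 (branch 2 4 (cycle
  10687342) (branch 2 5 (cycle 10673452) (branch 4 7 (cycle 10687432) (branch 5 7 (cycle 10675432)
  (cut 330220111))))) (branch 0 3 (branch 2 4 (cycle 10376542) (branch 2 5 (cycle 10378652)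
  (branch 2 6 (branch 4 7 (cycle 10347862) (branch 5 7 (cycle 10345762) (cut 330220111))) (branch
  1 6 (branch 5 7 (cycle 16875432) (branch 4 7 (branch 0 2 (cycle 10234786) (cut 222220103)) (cut
  330220111))) (cut 222220111))))) (branch 0 2 (branch 1 6 (branch 2 4 (cycle 10243786) (branch 2
  5 (cycle 16873452) (branch 4 7 (cycle 10234786) (branch 5 7 (cycle 16875432) (cut 330220111)))))
  (branch 1 3 (branch 2 4 (cycle 13786542) (branch 2 5 (cycle 10256873) (branch 2 6 (branch 4 7
  (cycle 10268743) (branch 5 7 (cycle 13457862) (cut 330220111))) (cut 222220111)))) (cut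
  222222011))) (cut 111111102)))))))) (branch 4 7 (branch 1 5 (cycle 15687432) (branch 0 5 (cycle
  10567432) (branch 0 6 (cycle 10687432) (branch 2 5 (branch 1 3 (cycle 13478652) (branch 0 3
  (cycle 10347652) (branch 0 4 (cycle 10478652) (branch 0 2 (branch 1 4 (cycle 10256874) (branch 1
  6 (cycle 10234786) (cut 222222011))) (cut 111111102))))) (branch 3 5 (branch 1 4 (cycle
  14786532) (branch 1 6 (cycle 16874532) (branch 0 4 (cycle 10476532) (branch 0 3 (branch 2 4
  (cycle 10356742) (branch 2 6 (cycle 10347862) (cut 222220111))) (branch 1 3 (branch 2 4 (cycle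
  13568742) (branch 2 6 (cycle 13547862) (cut 222220111))) (cut 222222011)))))) (branch 5 7
  (branch 1 6 (cycle 16875432) (branch 2 6 (branch 1 3 (cycle 13457862) (branch 0 3 (cycle
  10345762) (branch 3 6 (branch 1 4 (cycle 14578632) (branch 0 4 (cycle 10457632) (cut
  222222011))) (cut 333302011)))) (branch 3 6 (branch 1 4 (cycle 14578632) (branch 0 4 (cycle
  10457632) (branch 2 4 (branch 1 3 (cycle 13687542) (branch 0 3 (cycle 10367542) (cut
  222222011))) (cut 222220111)))) (cut 222201111)))) (cut 330201111))))))) (branch 5 7 (branch 1 6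
  (cycle 16875432) (branch 0 6 (cycle 10675432) (branch 2 6 (branch 1 3 (cycle 13457862) (branch 0
  3 (cycle 10345762) (branch 0 4 (cycle 10457862) (branch 0 5 (branch 1 4 (cycle 10576234) (branch
  3 6 (cycle 10578632) (branch 4 6 (cycle 10576432) (cut 333022011)))) (branch 0 2 (branch 1 4
  (cycle 10268754) (branch 1 5 (branch 3 6 (cycle 10236875) (branch 4 6 (cycle 15786432) (cut
  333022011))) (cut 222222011))) (cut 111111102)))))) (branch 3 6 (branch 1 4 (cycle 14578632)
  (branch 0 4 (cycle 10457632) (branch 0 5 (cycle 10578632) (branch 2 4 (branch 1 3 (cycle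
  13687542) (branch 1 5 (cycle 15786342) (branch 0 3 (cycle 10367542) (cut 222222011)))) (branch 4
  6 (branch 1 5 (cycle 15786432) (branch 2 5 (branch 1 3 (cycle 13468752) (branch 0 3 (cycle
  10346752) (cut 222222011))) (cut 222220111))) (cut 333020111)))))) (branch 4 6 (branch 1 5
  (cycle 15786432) (branch 0 5 (cycle 10576432) (branch 2 5 (branch 1 3 (cycle 13468752) (branch 0
  3 (cycle 10346752) (branch 3 5 (branch 1 4 (cycle 14687532) (branch 0 4 (cycle 10467532) (cut
  222222011))) (cut 333302011)))) (branch 3 5 (branch 1 4 (cycle 14687532) (branch 0 4 (cycle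
  10467532) (branch 2 4 (branch 1 3 (cycle 13578642) (branch 0 3 (cycle 10357642) (cut
  222222011))) (cut 222220111)))) (cut 222201111))))) (cut 222011111)))))) (cut 220111111))))))
  (cut 201111111))))))))

/-- The nontraceable case, for order 6. -/
def nontraceableTree6 : SearchTree :=
  branch 0 5 (path 501234) (branch 4 5 (path 543210) (branch 1 5 (branch 0 2 (path 510234) (branch
  0 4 (path 512340) (branch 2 5 (path 432510) (cut 320201)))) (branch 2 5 (branch 3 5 (path
  435210) (cut 211011)) (cut 210111))))

/-- The nontraceable case, for order 7. -/
def nontraceableTree7 : SearchTree :=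
  branch 0 6 (path 6012345) (branch 5 6 (path 6543210) (branch 3 6 (branch 0 5 (path 6345012)
  (branch 2 5 (path 6345210) (branch 2 6 (path 5436210) (branch 0 2 (branch 1 5 (path 6345120)
  (branch 1 6 (path 6102345) (cut 3200111))) (cut 4300201))))) (branch 4 6 (branch 0 5 (path
  6450123) (branch 3 5 (path 6453210) (branch 0 3 (branch 1 5 (path 6451230) (branch 2 5 (path
  6452301) (cut 1201111))) (cut 4302001)))) (branch 1 6 (branch 2 6 (path 5432610) (cut 2111101))
  (cut 2111011)))))

/-- The nontraceable case, for order 8. -/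
def nontraceableTree8 : SearchTree :=
  branch 0 7 (path 70123456) (branch 6 7 (path 76543210) (branch 3 7 (branch 0 4 (path 73210456)
  (branch 0 6 (path 73456012) (branch 2 6 (path 73456210) (branch 2 7 (path 65437210) (branch 4 7
  (path 65473210) (branch 4 6 (branch 0 5 (path 73465012) (branch 5 7 (path 75643210) (branch 0 2
  (branch 1 7 (path 71023456) (cut 21110111)) (cut 32220201)))) (branch 2 4 (branch 1 6 (path
  73245610) (branch 3 6 (path 73654210) (cut 12011111))) (cut 43020101)))))))) (branch 4 7 (branch
  0 5 (path 74321056) (branch 0 6 (path 74560123) (branch 3 6 (path 74563210) (branch 5 7 (path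
  65743210) (branch 2 7 (branch 0 3 (path 72103456) (branch 3 5 (path 65347210) (cut 43302001)))
  (branch 1 7 (branch 0 2 (path 71023456) (branch 0 3 (path 65471230) (cut 32202201))) (cut
  21101111))))))) (branch 5 7 (branch 0 6 (path 75601234) (branch 4 6 (path 75643210) (branch 2 7
  (branch 0 3 (path 72103456) (branch 0 4 (path 65723401) (branch 3 6 (path 63457210) (cut
  43022001)))) (branch 1 7 (branch 0 2 (path 71023456) (branch 0 4 (path 65712340) (branch 2 6
  (path 62345710) (cut 43020201)))) (cut 21011111))))) (branch 1 7 (branch 2 7 (path 65432710)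
  (cut 21111101)) (cut 21111011))))))

/-- The nontraceable case, for order 9. -/
def nontraceableTree9 : SearchTree :=
  branch 0 8 (path 801234567) (branch 7 8 (path 876543210) (branch 0 7 (branch 1 8 (path
  812345670) (branch 2 8 (path 823456701) (branch 3 8 (path 834567012) (branch 4 8 (path
  845670123) (branch 5 8 (path 856701234) (cut 210111111)))))) (branch 4 8 (branch 0 5 (path
  843210567) (branch 3 7 (path 845673210) (branch 3 8 (path 765483210) (branch 5 8 (path
  765843210) (branch 3 5 (branch 0 4 (path 840123567) (branch 0 6 (path 845321067) (branch 2 8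
  (path 765348210) (branch 6 8 (path 768453210) (branch 1 8 (branch 0 2 (path 810234567) (branch 0
  3 (path 765481230) (cut 222222201))) (cut 211101111)))))) (branch 0 3 (branch 2 5 (path
  843012567) (branch 1 7 (path 845671230) (branch 2 7 (path 845672301) (branch 1 8 (path
  765481230) (branch 2 8 (path 821034567) (branch 1 5 (branch 6 8 (path 768451230) (cut
  211101111)) (cut 320201111))))))) (branch 5 7 (branch 0 6 (path 845760123) (branch 3 6 (path
  845763210) (branch 6 8 (path 867543210) (cut 433302001)))) (cut 540302001)))))))) (branch 2 8
  (branch 0 3 (path 821034567) (branch 1 7 (path 823456710) (branch 1 8 (path 765432810) (branch 3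
  8 (path 765438210) (branch 5 8 (branch 0 4 (path 765823401) (branch 1 4 (path 765823410) (branch
  0 6 (path 854321067) (branch 3 7 (path 673458210) (branch 4 7 (path 856743210) (branch 1 3
  (branch 0 2 (path 820134567) (branch 2 4 (path 765824310) (branch 0 5 (branch 4 6 (path
  850123467) (dead 5)) (cut 222222201)))) (cut 430022011))))))) (branch 6 8 (branch 0 5 (path
  768234501) (branch 1 5 (path 768234510) (branch 3 7 (path 734568210) (branch 5 7 (path
  867543210) (branch 1 3 (branch 4 7 (path 745682310) (cut 320111011)) (cut 430202011)))))) (cut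
  211111011))))))) (branch 5 8 (branch 0 6 (path 854321067) (branch 4 7 (path 856743210) (branch 6
  8 (path 768543210) (branch 1 8 (branch 0 2 (path 810234567) (branch 0 4 (path 765812340) (branch
  2 7 (path 672345810) (branch 2 4 (branch 0 3 (path 810324567) (branch 3 8 (path 765834210) (cut
  322022201))) (cut 540030201))))) (branch 3 8 (branch 0 4 (path 832104567) (branch 2 4 (path
  765834210) (branch 4 6 (path 764583210) (branch 0 2 (branch 1 4 (path 832014567) (cut
  311020111)) (cut 422030201))))) (cut 211011111)))))) (branch 3 8 (branch 0 4 (path 832104567)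
  (branch 2 7 (path 834567210) (branch 6 8 (branch 0 5 (path 768345012) (branch 2 5 (path
  768345210) (branch 4 7 (path 745683210) (branch 5 7 (path 867543210) (branch 2 4 (branch 1 7
  (path 832456710) (branch 3 7 (path 837654210) (cut 120111111))) (cut 430220101)))))) (branch 1 8
  (branch 0 2 (path 810234567) (branch 2 4 (path 765423810) (branch 4 7 (branch 0 5 (path
  834765012) (branch 2 5 (path 834765210) (cut 430330201))) (cut 540030201)))) (cut 211110111)))))
  (branch 1 8 (branch 0 2 (path 810234567) (branch 6 8 (branch 0 5 (path 768123450) (branch 2 7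
  (path 723456810) (branch 5 7 (path 867543210) (branch 2 5 (branch 0 3 (path 768125430) (branch 0
  4 (path 810432567) (cut 320222201))) (cut 540300201))))) (cut 211111101))) (cut
  210111111))))))))

/-- The known edges form the cycle `1, …, 5` with the vertex `0` attached to `1`. Closing cycles
must be hamiltonian, and the path threshold `6 + 1` is never reached. With an empty list of graphs
no `iso` leaf is accepted. -/
lemma check_nearHamiltonianTree6 : check 6 6 (6 + 1) [] nearHamiltonianTree6
    (addEdge (pathMask (6 - 1)) 1 (6 - 1)) 0 = true := by
  decide +kernel

/-- The cycle threshold drops by one, as cycles missing exactly one vertex belong to the preceding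
case. -/
lemma check_traceableTree6 : check 6 (6 - 1) (6 + 1) []
    traceableTree6 (pathMask (6 - 1)) 0 = true := by
  decide +kernel

/-- Here the cycle threshold is out of reach, and a hamiltonian path closes a branch. The known
edges form a hamiltonian path of the graph without the vertex `5`. -/
lemma check_nontraceableTree6 : check 6 (6 + 1) 6 []
    nontraceableTree6 (pathMask (6 - 2)) 0 = true := by
  decide +kernel

lemma check_nearHamiltonianTree7 : check 7 7 (7 + 1) [] nearHamiltonianTree7
    (addEdge (pathMask (7 - 1)) 1 (7 - 1)) 0 = true := by
  decide +kernel

lemma check_traceableTree7 : check 7 (7 - 1) (7 + 1) []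
    traceableTree7 (pathMask (7 - 1)) 0 = true := by
  decide +kernel

lemma check_nontraceableTree7 : check 7 (7 + 1) 7 []
    nontraceableTree7 (pathMask (7 - 2)) 0 = true := by
  decide +kernel

lemma check_nearHamiltonianTree8 : check 8 8 (8 + 1) [] nearHamiltonianTree8
    (addEdge (pathMask (8 - 1)) 1 (8 - 1)) 0 = true := by
  decide +kernel

lemma check_traceableTree8 : check 8 (8 - 1) (8 + 1) []
    traceableTree8 (pathMask (8 - 1)) 0 = true := by
  decide +kernel

lemma check_nontraceableTree8 : check 8 (8 + 1) 8 []
    nontraceableTree8 (pathMask (8 - 2)) 0 = true := by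
  decide +kernel

/-- The only tree with `iso` leaves; all four graphs appear in it. -/
lemma check_nearHamiltonianTree9 : check 9 9 (9 + 1) ((List.range 4).map platypusEdges) nearHamiltonianTree9
    (addEdge (pathMask (9 - 1)) 1 (9 - 1)) 0 = true := by
  decide +kernel

lemma check_traceableTree9 : check 9 (9 - 1) (9 + 1) ((List.range 4).map platypusEdges)
    traceableTree9 (pathMask (9 - 1)) 0 = true := by
  decide +kernel

lemma check_nontraceableTree9 : check 9 (9 + 1) 9 ((List.range 4).map platypusEdges)
    nontraceableTree9 (pathMask (9 - 2)) 0 = true := by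
  decide +kernel

end SearchTree
end SimpleGraph

/-! ### Labelling an arbitrary platypus, and the classification up to order nine. -/

namespace SimpleGraph

variable {V : Type*} {G : SimpleGraph V}

lemma mem_of_nodup_of_length_eq_card [Fintype V] [DecidableEq V] {l : List V} (hl : l.Nodup)
    (h : l.length = Fintype.card V) (v : V) : v ∈ l := by
  have := (Finset.card_eq_iff_eq_univ l.toFinset).1 (by rw [List.toFinset_card_of_nodup hl, h])
  rw [← List.mem_toFinset, this]
  exact Finset.mem_univ v

lemma length_eq_card [Fintype V] [DecidableEq V] {l : List V} (hl : l.Nodup)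
    (h : ∀ v, v ∈ l) : l.length = Fintype.card V := by
  rw [← List.toFinset_card_of_nodup hl, Finset.card_eq_iff_eq_univ]
  ext v; simp [h]

lemma isLabelling_idxOf [DecidableEq V] {l : List V} (hl : l.Nodup) (hm : ∀ v, v ∈ l) :
    IsLabelling (fun v => l.idxOf v) l.length := by
  refine ⟨fun u v huv => (List.idxOf_inj (hm u)).1 huv, ?_⟩
  ext i
  constructor
  · rintro ⟨v, rfl⟩
    exact List.idxOf_lt_length_iff.2 (hm v)
  · intro hi
    exact ⟨l[i]'hi, hl.idxOf_getElem i hi⟩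

namespace SearchTree

lemma hasEdge_pathMask {k a b : ℕ} (hk : k < 16) (hb : b < 16)
    (h : hasEdge (pathMask k) a b = true) : (b = a + 1 ∧ a < k) ∨ (a = b + 1 ∧ b < k) := by
  induction k with
  | zero => simp [pathMask, hasEdge] at h
  | succ k ih =>
    rcases hasEdge_addEdge (by omega) hk hb h with h | h | h
    · have := ih (by omega) h; omega
    · omega
    · omega

lemma adj_of_hasEdge_pathMask [DecidableEq V] {l : List V} (hlen : l.length ≤ 16)
    (hm : ∀ v, v ∈ l) {k : ℕ} (hk : k < 16) (hch : (l.take (k + 1)).IsChain G.Adj) {u v : V}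
    (h : hasEdge (pathMask k) (l.idxOf u) (l.idxOf v) = true) : G.Adj u v := by
  have hlt : ∀ v, l.idxOf v < l.length := fun v => List.idxOf_lt_length_iff.2 (hm v)
  have key : ∀ u v, l.idxOf v = l.idxOf u + 1 → l.idxOf u < k → G.Adj u v := by
    intro u v huv hu
    have hv := hlt v
    have := List.isChain_iff_getElem.1 hch (l.idxOf u) (by
      rw [List.length_take]; omega)
    simp only [List.getElem_take, ← huv, List.getElem_idxOf] at this
    exact this
  rcases hasEdge_pathMask hk ((hlt v).trans_le hlen) h with h | h
  · exact key u v h.1 h.2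
  · exact (key v u h.1 h.2).symm

/-- Three decision trees, for the platypuses with a cycle missing just one vertex, the other
traceable platypuses and the nontraceable ones, classify the platypuses of order `n`. -/
theorem exists_iso_of_checks [Fintype V] [DecidableEq V] (hG : G.IsPlatypus) {n : ℕ}
    (hcard : Fintype.card V = n) (hn4 : 4 ≤ n) (hn : n ≤ 16) {Ts : List (List (ℕ × ℕ))}
    {T₁ T₂ T₃ : SearchTree}
    (h₁ : check n n (n + 1) Ts T₁ (addEdge (pathMask (n - 1)) 1 (n - 1)) 0 = true)
    (h₂ : check n (n - 1) (n + 1) Ts T₂ (pathMask (n - 1)) 0 = true)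
    (h₃ : check n (n + 1) n Ts T₃ (pathMask (n - 2)) 0 = true) :
    ∃ es ∈ Ts, Nonempty (G ≃g ofEdges n es) := by
  have hle : ∀ l : List V, l.Nodup → l.length ≤ n := fun l hl => hcard ▸ hl.length_le_card
  have hcyc : ∀ l, G.IsCycleList l → l.length < n := by
    intro l hl
    refine lt_of_le_of_ne (hle l hl.2.1) fun h => ?_
    obtain ⟨v, hv⟩ := hG.exists_notMem hl
    exact hv (mem_of_nodup_of_length_eq_card hl.2.1 (h.trans hcard.symm) v)
  have hN : ∀ {g : V → ℕ} (u v : V), hasEdge 0 (g u) (g v) = true → ¬ G.Adj u v := by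
    intro g u v h
    simp [hasEdge] at h
  by_cases hA : ∃ l, G.IsCycleList l ∧ l.length = n - 1
  · obtain ⟨l, hl, hlen⟩ := hA
    obtain ⟨v, hv⟩ := hG.exists_notMem hl
    obtain ⟨u, -, hvu⟩ := hG.exists_adj_ne v v
    have hvl : (v :: l).Nodup := List.nodup_cons.2 ⟨hv, hl.2.1⟩
    have hu : u ∈ l := by
      have := mem_of_nodup_of_length_eq_card hvl (by simp; omega) u
      exact (List.mem_cons.1 this).resolve_left hvu.ne'
    -- The cycle is rotated to begin at a neighbour `u` of the missing vertex `v`. Then `v` gets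
    -- label `0`, `u` gets label `1`, and the last vertex of the cycle gets label `n - 1`.
    obtain ⟨B, C, rfl⟩ := List.append_of_mem hu
    have hl' := hl.rotate
    rw [List.cons_append] at hl'
    have hlen' : (u :: (C ++ B)).length = n - 1 := by rw [← hlen]; simp; omega
    have hv' : v ∉ u :: (C ++ B) := by simp at hv ⊢; tauto
    generalize C ++ B = c at hl' hlen' hv'
    have hnd : (v :: u :: c).Nodup := List.nodup_cons.2 ⟨hv', hl'.2.1⟩
    have hlen2 : (v :: u :: c).length = n := by rw [List.length_cons, hlen']; omega
    have hm := mem_of_nodup_of_length_eq_card hnd (hlen2.trans hcard.symm)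
    have hg := isLabelling_idxOf hnd hm
    rw [hlen2] at hg
    refine exists_iso_of_check hG hg hcard hn hcyc (fun l hl => Nat.lt_succ_of_le (hle l hl.1))
      T₁ (fun x y hxy => ?_) hN h₁
    have hlt : ∀ x, List.idxOf x (v :: u :: c) < 16 := fun x => (hg.lt x).trans_le hn
    have hinj : ∀ {x y i}, List.idxOf x (v :: u :: c) = i → List.idxOf y (v :: u :: c) = i → x = y :=
      fun h h' => hg.injective (h.trans h'.symm)
    -- The closing edge of the cycle justifies the extra known edge between `1` and `n - 1`.
    have hlast : ∃ w, G.Adj w u ∧ List.idxOf w (v :: u :: c) = n - 1 := by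
      refine ⟨(v :: u :: c)[n - 1]'(by omega), hl'.2.2.2 _ ?_ u (by simp), ?_⟩
      · rw [Option.mem_def, List.getLast?_eq_getElem?, hlen', List.getElem?_eq_getElem (by omega)]
        congr 1
        conv_rhs => rw [List.getElem_cons, dif_neg (by omega)]
      · exact hnd.idxOf_getElem _ _
    obtain ⟨w, hwu, hw⟩ := hlast
    have hu1 : List.idxOf u (v :: u :: c) = 1 := by
      simp [List.idxOf_cons_ne _ hvu.ne]
    rcases hasEdge_addEdge (by omega) (by omega) (hlt y) hxy with h | h | h
    · refine adj_of_hasEdge_pathMask (by omega) hm (by omega) ?_ h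
      refine List.IsChain.take ?_ _
      exact List.isChain_cons_cons.2 ⟨hvu, hl'.2.2.1⟩
    · rw [hinj h.1 hu1, hinj h.2 hw]; exact hwu.symm
    · rw [hinj h.2 hu1, hinj h.1 hw]; exact hwu
  by_cases hB : ∃ l, G.IsPathList l ∧ l.length = n
  · obtain ⟨l, hl, hlen⟩ := hB
    have hm := mem_of_nodup_of_length_eq_card hl.1 (hlen.trans hcard.symm)
    have hg := isLabelling_idxOf hl.1 hm
    rw [hlen] at hg
    refine exists_iso_of_check hG hg hcard hn (fun l hl => ?_)
      (fun l hl => Nat.lt_succ_of_le (hle l hl.1)) T₂ (fun x y hxy => ?_) hN h₂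
    · have := hcyc l hl
      have : l.length ≠ n - 1 := fun h => hA ⟨l, hl, h⟩
      omega
    · exact adj_of_hasEdge_pathMask (by omega) hm (by omega) (hl.2.take _) hxy
  -- In the nontraceable case an arbitrary `v` gets the last label `n - 1`, and a hamiltonian path
  -- of `G - v` supplies the labels `0, …, n - 2`.
  · obtain ⟨v⟩ : Nonempty V := Fintype.card_pos_iff.1 (by omega)
    obtain ⟨l, hl, hlv⟩ := hG.exists_isPathList v
    have hnd : (l ++ [v]).Nodup :=
      List.nodup_append_comm.1 (List.nodup_cons.2 ⟨fun h => (hlv v).1 h rfl, hl.1⟩)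
    have hm : ∀ u, u ∈ l ++ [v] := fun u => by
      by_cases hu : u = v <;> simp [hlv, hu]
    have hlen := (length_eq_card hnd hm).trans hcard
    have hg := isLabelling_idxOf hnd hm
    rw [hlen] at hg
    refine exists_iso_of_check hG hg hcard hn (fun l hl => (hcyc l hl).trans (Nat.lt_succ_self n))
      (fun l hl => lt_of_le_of_ne (hle l hl.1) fun h => hB ⟨l, hl, h⟩) T₃ (fun x y hxy => ?_) hN h₃
    refine adj_of_hasEdge_pathMask (by omega) hm (by omega) ?_ hxy
    have : n - 2 + 1 = l.length := by simp at hlen; omega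
    rw [this, List.take_left]
    exact hl.2

end SearchTree

open SearchTree in
/-- Every platypus on at most nine vertices is one of four graphs on nine vertices. -/
theorem IsPlatypus.exists_iso_platypusEdges [Fintype V] [DecidableEq V] (hG : G.IsPlatypus)
    (h9 : Fintype.card V ≤ 9) :
    ∃ k : Fin 4, Nonempty (G ≃g ofEdges 9 (platypusEdges k)) := by
  classical
  -- Some degree is at least two, and every degree is at most the order minus four.
  have h6 : 6 ≤ Fintype.card V := by
    obtain ⟨v⟩ : Nonempty V := Fintype.card_pos_iff.1 (by have := hG.three_le_card; omega)
    obtain ⟨a, -, ha⟩ := hG.exists_adj_ne v v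
    obtain ⟨b, hba, hb⟩ := hG.exists_adj_ne v a
    have h2 : 2 ≤ G.degree v := by
      rw [← Finset.card_pair hba, ← card_neighborFinset_eq_degree]
      refine Finset.card_le_card fun w hw => ?_
      rw [mem_neighborFinset]
      rcases Finset.mem_insert.1 hw with rfl | hw
      · exact hb
      · rwa [Finset.mem_singleton.1 hw]
    have := hG.degree_add_four_le v
    omega
  obtain h | h | h | h : Fintype.card V = 6 ∨ Fintype.card V = 7 ∨ Fintype.card V = 8 ∨
    Fintype.card V = 9 := by omega
  -- The list of admissible graphs is empty for the orders six, seven and eight, so these cases are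
  -- contradictory.
  · obtain ⟨es, hes, -⟩ := exists_iso_of_checks hG h (by norm_num) (by norm_num)
      check_nearHamiltonianTree6 check_traceableTree6 check_nontraceableTree6
    cases hes
  · obtain ⟨es, hes, -⟩ := exists_iso_of_checks hG h (by norm_num) (by norm_num)
      check_nearHamiltonianTree7 check_traceableTree7 check_nontraceableTree7
    cases hes
  · obtain ⟨es, hes, -⟩ := exists_iso_of_checks hG h (by norm_num) (by norm_num)
      check_nearHamiltonianTree8 check_traceableTree8 check_nontraceableTree8
    cases hes
  · obtain ⟨es, hes, hiso⟩ := exists_iso_of_checks hG h (by norm_num) (by norm_num)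
      check_nearHamiltonianTree9 check_traceableTree9 check_nontraceableTree9
    obtain ⟨k, hk, rfl⟩ := List.mem_map.1 hes
    exact ⟨⟨k, List.mem_range.1 hk⟩, hiso⟩

end SimpleGraph

/-! ### Invariance under isomorphism, and twins of simplicial vertices. -/

namespace SimpleGraph

variable {V W : Type*} {G : SimpleGraph V} {H : SimpleGraph W}

lemma IsPathList.map_iso (e : G ≃g H) {l : List V} (hl : G.IsPathList l) :
    H.IsPathList (l.map e) := by
  refine ⟨hl.1.map e.injective, ?_⟩
  rw [List.isChain_map]
  exact hl.2.imp fun _ _ h => e.map_adj_iff.2 h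

lemma IsCycleList.map_iso (e : G ≃g H) {l : List V} (hl : G.IsCycleList l) :
    H.IsCycleList (l.map e) := by
  obtain ⟨h1, h2, h3, h4⟩ := hl
  obtain ⟨h5, h6⟩ := IsPathList.map_iso e ⟨h2, h3⟩
  refine ⟨by simpa using h1, h5, h6, fun a ha b hb => ?_⟩
  rw [List.getLast?_map, Option.mem_def, Option.map_eq_some_iff] at ha
  rw [List.head?_map, Option.mem_def, Option.map_eq_some_iff] at hb
  obtain ⟨a, ha, rfl⟩ := ha
  obtain ⟨b, hb, rfl⟩ := hb
  exact e.map_adj_iff.2 (h4 a ha b hb)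

lemma IsPlatypus.of_iso [Fintype V] [DecidableEq V] [Fintype W] [DecidableEq W]
    (hG : G.IsPlatypus) (e : G ≃g H) : H.IsPlatypus := by
  rw [isPlatypus_iff]
  refine ⟨by rw [← Fintype.card_congr e.toEquiv]; exact hG.three_le_card, fun l hl => ?_,
    fun v => ?_⟩
  · obtain ⟨v, hv⟩ := hG.exists_notMem (hl.map_iso e.symm)
    exact ⟨e v, fun h => hv (List.mem_map.2 ⟨e v, h, e.symm_apply_apply v⟩)⟩
  · obtain ⟨l, hl, hm⟩ := hG.exists_isPathList (e.symm v)
    refine ⟨l.map e, hl.map_iso e, fun u => ?_⟩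
    rw [List.mem_map]
    constructor
    · rintro ⟨w, hw, rfl⟩ rfl
      exact (hm w).1 hw (e.symm_apply_apply w).symm
    · intro hu
      exact ⟨e.symm u, (hm _).2 fun h => hu (e.symm.injective h), e.apply_symm_apply u⟩

/-- The graph obtained from `G` by adding a new vertex adjacent to `c` and its neighbours. -/
def addTwin (G : SimpleGraph V) (c : V) : SimpleGraph (Option V) where
  Adj
    | none, none => False
    | none, some v => v = c ∨ G.Adj c v
    | some u, none => u = c ∨ G.Adj c u
    | some u, some v => G.Adj u v
  symm := ⟨by rintro (_ | u) (_ | v) h <;> first | exact h | exact G.symm.symm _ _ h⟩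
  loopless := ⟨by rintro (_ | u) h <;> first | exact h | exact G.loopless.irrefl _ h⟩

/-- A vertex is simplicial if its neighbours are pairwise adjacent. -/
def IsSimplicial (G : SimpleGraph V) (c : V) : Prop :=
  ∀ a b, G.Adj c a → G.Adj c b → a ≠ b → G.Adj a b

/-- Allows the twin construction to be iterated at the same vertex. -/
lemma IsSimplicial.addTwin {c : V} (hc : G.IsSimplicial c) :
    (G.addTwin c).IsSimplicial (some c) := by
  rintro (_ | a) (_ | b) ha hb hab
  · exact absurd rfl hab
  · exact .inr hb
  · exact .inr ha
  · exact hc a b ha hb fun h => hab (congrArg some h)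

lemma IsPathList.map_some {c : V} {l : List V} (hl : G.IsPathList l) :
    (G.addTwin c).IsPathList (l.map some) := by
  refine ⟨hl.1.map (Option.some_injective V), ?_⟩
  rw [List.isChain_map]
  exact hl.2

/-- A path through `c` can be extended by a twin of `c`. -/
lemma IsPathList.exists_addTwin {c : V} {l : List V} (hl : G.IsPathList l) (hc : c ∈ l) :
    ∃ l', (G.addTwin c).IsPathList l' ∧ none ∈ l' ∧ ∀ v, some v ∈ l' ↔ v ∈ l := by
  obtain ⟨A, B, rfl⟩ := List.append_of_mem hc
  have h := hl.map_some (c := c)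
  rw [List.map_append, List.map_cons] at h
  refine ⟨A.map some ++ some c :: none :: B.map some, ⟨?_, ?_⟩, by simp, by simp⟩
  · have hp : (none :: (A.map some ++ some c :: B.map some)).Perm
        (A.map some ++ some c :: none :: B.map some) := by
      refine List.perm_middle.symm.trans (List.Perm.append_left _ ?_)
      exact List.Perm.swap _ _ _
    refine hp.nodup_iff.1 (List.nodup_cons.2 ⟨by simp, h.1⟩)
  · have h2 := h.2
    rw [List.isChain_append] at h2 ⊢
    refine ⟨h2.1, ?_, by simpa using h2.2.2⟩
    refine List.isChain_cons_cons.2 ⟨.inl rfl, ?_⟩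
    rcases B with _ | ⟨b, B⟩
    · simp
    · rw [List.map_cons, List.isChain_cons_cons] at h2
      rw [List.map_cons, List.isChain_cons_cons]
      exact ⟨.inr h2.2.1.1, h2.2.1.2⟩

/-- The closed neighbourhood of `c` is a clique, so the twin can be cut out of a hamiltonian cycle
by joining its two cycle neighbours; hence none exists. Deleting the twin or `c` leaves a copy of
`G`, which is why `G` itself must be traceable. -/
lemma IsPlatypus.addTwin [Fintype V] [DecidableEq V] (hG : G.IsPlatypus)
    (htr : ∃ l, G.IsPathList l ∧ ∀ v, v ∈ l) {c : V} (hc : G.IsSimplicial c) :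
    (G.addTwin c).IsPlatypus := by
  rw [isPlatypus_iff]
  refine ⟨by rw [Fintype.card_option]; have := hG.three_le_card; omega, fun l hl => ?_, ?_⟩
  · by_contra! hm
    obtain ⟨A, B, rfl⟩ := List.append_of_mem (hm none)
    have hl' := hl.rotate
    have hm' : ∀ v, some v ∈ B ++ A := fun v => by have := hm (some v); simp at this ⊢; tauto
    rw [List.cons_append] at hl'
    obtain ⟨h1, h2, h3, h4⟩ := hl'
    generalize B ++ A = t at *
    rw [List.nodup_cons] at h2
    obtain ⟨t, rfl⟩ : ∃ t' : List V, t'.map some = t := by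
      have : t ∈ Set.range (List.map (some : V → Option V)) := by
        rw [Set.range_list_map]
        rintro (_ | v) hv
        · exact absurd hv h2.1
        · exact ⟨v, rfl⟩
      exact this
    simp only [List.mem_map, Option.some.injEq, exists_eq_right] at hm'
    have hnd : t.Nodup := h2.2.of_map
    rw [List.isChain_cons] at h3
    have hch : t.IsChain G.Adj := by
      have := h3.2
      rw [List.isChain_map] at this
      exact this
    have hlen : 3 ≤ t.length := by
      rw [length_eq_card hnd hm']; exact hG.three_le_card
    suffices h : G.IsCycleList t by
      obtain ⟨v, hv⟩ := hG.exists_notMem h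
      exact hv (hm' v)
    refine ⟨hlen, hnd, hch, fun a ha b hb => ?_⟩
    -- The ends `a` and `b` of `t` are the cycle neighbours of the twin, so they lie in the closed
    -- neighbourhood of `c`.
    have hb' : b = c ∨ G.Adj c b := by
      refine h3.1 (some b) ?_
      rw [Option.mem_def] at hb
      simp [List.head?_map, hb]
    have ha' : a = c ∨ G.Adj c a := by
      refine h4 (some a) ?_ none (by simp)
      rw [Option.mem_def] at ha
      simp [List.getLast?_cons, List.getLast?_map, ha]
    have hab : a ≠ b := by
      rintro rfl
      rcases t with _ | ⟨x, t⟩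
      · simp at hb
      · have hxa : x = a := by simpa using hb
        subst hxa
        rcases t.eq_nil_or_concat with rfl | ⟨t, y, rfl⟩
        · simp at hlen
        · have hyx : y = x := by simpa [List.getLast?_cons] using ha
          subst hyx
          simp at hnd
    rcases ha' with rfl | ha' <;> rcases hb' with rfl | hb'
    · exact absurd rfl hab
    · exact hb'
    · exact ha'.symm
    · exact hc a b ha' hb' hab
  · rintro (_ | v)
    · obtain ⟨l, hl, hm⟩ := htr
      refine ⟨l.map some, hl.map_some, ?_⟩
      rintro (_ | u) <;> simp [hm]
    by_cases hv : v = c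
    -- The twin takes the place of `c` in a hamiltonian path of `G`.
    · subst hv
      obtain ⟨l, hl, hm⟩ := htr
      obtain ⟨A, B, rfl⟩ := List.append_of_mem (hm v)
      have h := hl.map_some (c := v)
      rw [List.map_append, List.map_cons] at h
      have hnd := hl.1
      refine ⟨A.map some ++ none :: B.map some, ⟨?_, ?_⟩, ?_⟩
      · refine List.nodup_middle.2 (List.nodup_cons.2 ⟨by simp, ?_⟩)
        exact (List.nodup_cons.1 (List.nodup_middle.1 h.1)).2
      · have h2 := h.2
        rw [List.isChain_append] at h2 ⊢
        refine ⟨h2.1, ?_, ?_⟩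
        · rw [List.isChain_cons] at h2 ⊢
          refine ⟨fun y hy => ?_, h2.2.1.2⟩
          obtain ⟨z, -, rfl⟩ := List.mem_map.1 (List.mem_of_mem_head? hy)
          exact .inr (h2.2.1.1 _ hy)
        · intro x hx y hy
          obtain ⟨z, -, rfl⟩ := List.mem_map.1 (List.mem_of_mem_getLast? hx)
          have hy' : y = none := by simpa using hy.symm
          subst hy'
          exact .inr (G.symm.symm _ _ (h2.2.2 _ hx (some v) (by simp)))
      · have hvAB := (List.nodup_cons.1 (List.nodup_middle.1 hnd)).1
        rintro (_ | u)
        · simp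
        · have hu := hm u
          simp only [List.mem_append, List.mem_cons, List.mem_map, Option.some.injEq,
            exists_eq_right, ne_eq, reduceCtorEq, false_or] at hu hvAB ⊢
          constructor
          · rintro hu' rfl; exact hvAB hu'
          · tauto
    -- For the other vertices, the twin is inserted directly after `c` in a hamiltonian path of `G -
    -- v`.
    · obtain ⟨l, hl, hm⟩ := hG.exists_isPathList v
      obtain ⟨l', hl', hn, hs⟩ := hl.exists_addTwin ((hm c).2 (Ne.symm hv))
      refine ⟨l', hl', ?_⟩
      rintro (_ | u)
      · simpa using hn
      · rw [hs, hm]; simp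

end SimpleGraph

/-! ### Explicit platypuses and the extremal family. -/

namespace SimpleGraph

lemma isLabelling_fin_val (n : ℕ) : IsLabelling (Fin.val : Fin n → ℕ) n :=
  ⟨Fin.val_injective, by ext i; exact ⟨fun ⟨v, hv⟩ => hv ▸ v.2, fun hi => ⟨⟨i, hi⟩, rfl⟩⟩⟩

lemma isPlatypus_ofEdges {n : ℕ} {es : List (ℕ × ℕ)} (hn : 3 ≤ n)
    (h : searchCycle (fun i j => es.elem (i, j) || es.elem (j, i)) n = false)
    (paths : List (List (Fin n)))
    (hp : ∀ v, ∃ l ∈ paths, (l.Nodup ∧ l.IsChain (ofEdges n es).Adj) ∧ ∀ u, u ∈ l ↔ u ≠ v) :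
    (ofEdges n es).IsPlatypus := by
  rw [isPlatypus_iff]
  refine ⟨by simpa using hn, fun l hl => ?_, fun v => ?_⟩
  · by_contra! hm
    rw [searchCycle_eq_true (isLabelling_fin_val n) (fun u v huv => ?_) hl hm] at h
    · cases h
    · rw [Bool.or_eq_true, List.elem_iff, List.elem_iff]
      exact huv.2
  · obtain ⟨l, -, hl⟩ := hp v
    exact ⟨l, hl⟩

/-- The search refutes hamiltonian cycles for a simple reason: such a cycle contains all three
connecting paths because of their middle vertices of degree two. An extra edge would close a
triangle with one of these paths, so the three vertices of each original triangle would have to be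
matched among themselves. The nine listed paths avoid the extra edges and so serve all four graphs.
-/
lemma isPlatypus_platypusEdges (k : Fin 4) : (ofEdges 9 (platypusEdges k)).IsPlatypus := by
  refine isPlatypus_ofEdges (by norm_num) (by revert k; decide +kernel)
    [[3, 6, 7, 4, 1, 2, 5, 8], [3, 0, 2, 5, 8, 6, 7, 4], [3, 0, 1, 4, 7, 6, 8, 5], [0, 1, 2, 5,
    8, 6, 7, 4], [0, 1, 2, 5, 8, 7, 6, 3], [0, 2, 1, 4, 7, 8, 6, 3], [1, 4, 7, 8, 5, 2, 0, 3],
    [0, 3, 6, 8, 5, 2, 1, 4], [0, 3, 6, 7, 4, 1, 2, 5]] ?_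
  revert k
  decide +kernel

/-- The edges of a platypus of order ten and maximum degree six. -/
def tenVertexEdges : List (ℕ × ℕ) :=
  [(0, 1), (1, 2), (2, 3), (0, 4), (3, 4), (4, 5), (1, 6), (5, 6), (3, 7), (6, 7), (7, 8), (1,
  9), (2, 9), (4, 9), (5, 9), (7, 9), (8, 9)]

lemma isPlatypus_tenVertexEdges : (ofEdges 10 tenVertexEdges).IsPlatypus := by
  refine isPlatypus_ofEdges (by norm_num) (by decide +kernel)
    [[1, 2, 3, 4, 5, 6, 7, 8, 9], [0, 4, 3, 2, 9, 5, 6, 7, 8], [0, 1, 6, 5, 4, 3, 7, 8, 9], [0,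
    1, 2, 9, 4, 5, 6, 7, 8], [0, 1, 2, 3, 7, 6, 5, 9, 8], [0, 1, 2, 3, 4, 9, 8, 7, 6], [0, 1, 2,
    3, 4, 5, 9, 7, 8], [0, 1, 6, 5, 4, 3, 2, 9, 8], [0, 1, 2, 3, 4, 5, 6, 7, 9], [0, 1, 2, 3, 4,
    5, 6, 7, 8]] ?_
  decide +kernel

/-- For every `n ≥ 10` there is a platypus of order `n` with a vertex of degree `n - 4`. -/
lemma exists_isPlatypus_of_ten_le (n : ℕ) (hn : 10 ≤ n) :
    ∃ (G : SimpleGraph (Fin n)) (x c : Fin n) (S : Finset (Fin n)), G.IsPlatypus ∧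
      (∃ l, G.IsPathList l ∧ ∀ v, v ∈ l) ∧ G.IsSimplicial c ∧ G.Adj x c ∧ S.card ≤ 4 ∧
      ∀ v ∉ S, G.Adj x v := by
  induction n, hn using Nat.le_induction with
  | base =>
    -- The vertex `9` misses only `0`, `3`, `6` and itself, and `8` is simplicial since its
    -- neighbours `7` and `9` are adjacent.
    refine ⟨ofEdges 10 tenVertexEdges, 9, 8, {0, 3, 6, 9}, isPlatypus_tenVertexEdges,
      ⟨[0, 1, 2, 3, 4, 5, 6, 7, 8, 9], ⟨?_, ?_⟩, ?_⟩, ?_, ?_, ?_, ?_⟩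
    · decide +kernel
    · decide +kernel
    · decide +kernel
    · unfold IsSimplicial; decide +kernel
    · decide +kernel
    · decide +kernel
    · decide +kernel
  | succ n hn ih =>
    obtain ⟨G, x, c, S, hG, ⟨l, hl, hm⟩, hc, hxc, hS, hxS⟩ := ih
    let e : Option (Fin n) ≃ Fin (n + 1) := (finSuccEquiv n).symm
    let φ : G.addTwin c ≃g (G.addTwin c).map e.toEmbedding := Iso.map e _
    -- Being adjacent to `c`, the vertex `x` is also adjacent to the twin, so the exceptional set
    -- `S` does not grow.
    obtain ⟨l', hl', hn', hs'⟩ := hl.exists_addTwin (hm c)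
    refine ⟨(G.addTwin c).map e.toEmbedding, e (some x), e (some c),
      (S.map Function.Embedding.some).map e.toEmbedding, (hG.addTwin ⟨l, hl, hm⟩ hc).of_iso φ,
      ⟨l'.map φ, hl'.map_iso φ, fun v => ?_⟩, ?_, ?_, by simpa using hS, fun v hv => ?_⟩
    · obtain ⟨(_ | u), rfl⟩ := φ.surjective v
      · exact List.mem_map.2 ⟨none, hn', rfl⟩
      · exact List.mem_map.2 ⟨some u, (hs' u).2 (hm u), rfl⟩
    · intro a b ha hb hab
      obtain ⟨a, rfl⟩ := φ.surjective a
      obtain ⟨b, rfl⟩ := φ.surjective b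
      exact φ.map_adj_iff.2 (hc.addTwin a b (φ.map_adj_iff.1 ha) (φ.map_adj_iff.1 hb)
        fun h => hab (congrArg φ h))
    · exact φ.map_adj_iff.2 (show (G.addTwin c).Adj (some x) (some c) from hxc)
    · obtain ⟨(_ | u), rfl⟩ := φ.surjective v
      · exact φ.map_adj_iff.2 (show (G.addTwin c).Adj (some x) none from .inr hxc.symm)
      · refine φ.map_adj_iff.2 (show (G.addTwin c).Adj (some x) (some u) from hxS u fun hu => hv ?_)
        exact Finset.mem_map.2 ⟨some u, Finset.mem_map.2 ⟨u, hu, rfl⟩, rfl⟩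

/-- The number of edges, `12 + k`, distinguishes the four graphs. -/
lemma isEmpty_iso_platypusEdges {i j : Fin 4} (hij : i ≠ j) :
    IsEmpty (ofEdges 9 (platypusEdges i) ≃g ofEdges 9 (platypusEdges j)) := by
  refine ⟨fun e => ?_⟩
  have h1 := e.card_edgeFinset_eq
  have h2 : ∀ k : Fin 4, (ofEdges 9 (platypusEdges k)).edgeFinset.card = 12 + k := by
    decide +kernel
  rw [h2, h2] at h1
  exact hij (Fin.ext (by omega))

end SimpleGraph

/-! ### Assembly of the theorem. -/

open SimpleGraph

theorem mainTheorem1 :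
    -- every platypus of order `n` has maximum degree at most `n - 4`
    (∀ (V : Type*) [Fintype V] [DecidableEq V] (G : SimpleGraph V) [DecidableRel G.Adj],
      G.IsPlatypus → (G.maxDegree : ℤ) ≤ (Fintype.card V : ℤ) - 4) ∧
    -- up to isomorphism, the platypuses of order at most 9 are four graphs of order 9,
    -- one of maximum degree 3 and three of maximum degree 4
    (∃ (P : Fin 4 → SimpleGraph (Fin 9)) (_ : ∀ i, DecidableRel (P i).Adj),
      (∀ i, (P i).IsPlatypus) ∧
      (∀ i j, i ≠ j → IsEmpty (P i ≃g P j)) ∧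
      (P 0).maxDegree = 3 ∧ (P 1).maxDegree = 4 ∧ (P 2).maxDegree = 4 ∧ (P 3).maxDegree = 4 ∧
      ∀ (V : Type*) [Fintype V] [DecidableEq V] (G : SimpleGraph V),
        Fintype.card V ≤ 9 → G.IsPlatypus → ∃ i, Nonempty (G ≃g P i)) ∧
    -- hence the bound is not sharp for `n = 9`
    (∀ (V : Type*) [Fintype V] [DecidableEq V] (G : SimpleGraph V) [DecidableRel G.Adj],
      Fintype.card V = 9 → G.IsPlatypus → G.maxDegree < 9 - 4) ∧
    -- for every `n ≥ 10` the bound is attained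
    (∀ n : ℕ, 10 ≤ n → ∃ (G : SimpleGraph (Fin n)) (_ : DecidableRel G.Adj),
      G.IsPlatypus ∧ G.maxDegree = n - 4) := by
  have hmax : ∀ k : Fin 4, (ofEdges 9 (platypusEdges k)).maxDegree = if k = 0 then 3 else 4 := by
    decide +kernel
  refine ⟨fun V _ _ G _ hG => by have := hG.maxDegree_add_four_le; omega,
    ⟨fun k => ofEdges 9 (platypusEdges k), fun _ => inferInstance, isPlatypus_platypusEdges,
      fun i j hij => isEmpty_iso_platypusEdges hij, hmax 0, hmax 1, hmax 2, hmax 3,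
      fun V _ _ G h9 hG => hG.exists_iso_platypusEdges h9⟩,
    fun V _ _ G _ h9 hG => ?_, fun n hn => ?_⟩
  · obtain ⟨k, ⟨e⟩⟩ := hG.exists_iso_platypusEdges h9.le
    rw [e.maxDegree_eq, hmax]
    split_ifs <;> norm_num
  · classical
    obtain ⟨G, x, c, S, hG, -, -, -, hS, hxS⟩ := exists_isPlatypus_of_ten_le n hn
    refine ⟨G, Classical.decRel _, hG, le_antisymm ?_ ?_⟩
    · have := hG.maxDegree_add_four_le
      rw [Fintype.card_fin] at this
      omega
    · refine le_trans ?_ (G.degree_le_maxDegree x)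
      -- All but at most four vertices are neighbours of `x`, so its degree attains the upper bound.
      have hsub : Sᶜ ⊆ G.neighborFinset x := fun v hv => by
        rw [mem_neighborFinset]
        exact hxS v (Finset.mem_compl.1 hv)
      have := Finset.card_le_card hsub
      rw [Finset.card_compl, Fintype.card_fin, card_neighborFinset_eq_degree] at this
      omega
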